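/- The terms of the theory of Beta-Bernoulli live in contexts $\Gamma\mid\Delta$, where $\Gamma=(p_1,\dots,p_\ell)$ is a list of parameters and $\Delta=(x_1:m_1,\dots,x_k:m_k)$ a list of variables, $x_i$ expecting $m_i\ge 0$ parameters. They are generated by the following rules, and are taken up to renaming of bound parameters: - $\Gamma\mid\Delta\vdash x_i(q_1,\dots,q_{m_i})$ for $q_1,\dots,q_{m_i}\in\Gamma$; - $\Gamma\mid\Delta\vdash \nu_{i,j}p.\,t$ for integers $i,j>0$, if $\Gamma,p\mid\Delta\vdash t$ (this binds $p$); - $\Gamma\mid\Delta\vdash t\,?_p\,u$ for $p\in\Gamma$, if $\Gamma\mid\Delta\vdash t$ and $\Gamma\mid\Delta\vdash u$; - $\Gamma\mid\Delta\vdash t\;{}_i?_j\;u$ for integers $i,j\ge 0$ with $i+j>0$, if $\Gamma\mid\Delta\vdash t$ and $\Gamma\mid\Delta\vdash u$. Derivable equality $\Gamma\mid\Delta\vdash t=u$ is the closure under (capture-avoiding) substitution of parameters and of terms, congruence, reflexivity, symmetry and transitivity of the following axioms, for all indices for which both sides are terms. Variables written without arguments expect $0$ parameters; $x(p)$ and $x(p,q)$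 indicate that $x$ expects $1$ and $2$ parameters. - Rational convexity: $(w\,{}_i?_j\,x)\;{}_{i+j}?_{k+l}\;(y\,{}_k?_l\,z)=(w\,{}_i?_k\,y)\;{}_{i+k}?_{j+l}\;(x\,{}_j?_l\,z)$; $x\,{}_i?_j\,y=y\,{}_j?_i\,x$; $x\,{}_i?_0\,y=x$; $x\,{}_i?_j\,x=x$. - Commutativity: $(w\,?_q\,x)\,?_p\,(y\,?_q\,z)=(w\,?_p\,y)\,?_q\,(x\,?_p\,z)$; $\nu_{i,j}p.\nu_{k,l}q.\,x(p,q)=\nu_{k,l}q.\nu_{i,j}p.\,x(p,q)$; $\nu_{i,j}p.(x(p)\,?_q\,y(p))=(\nu_{i,j}p.\,x(p))\,?_q\,(\nu_{i,j}p.\,y(p))$; $\nu_{i,j}p.(x(p)\,{}_k?_l\,y(p))=(\nu_{i,j}p.\,x(p))\,{}_k?_l\,(\nu_{i,j}p.\,y(p))$; $(w\,{}_i?_j\,x)\,?_p\,(y\,{}_i?_j\,z)=(w\,?_p\,y)\,{}_i?_j\,(x\,?_p\,z)$. - Discardability: $\nu_{i,j}p.\,x=x$; $x\,?_p\,x=x$.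 - Conjugacy: $\nu_{i,j}p.(x(p)\,?_p\,y(p))=(\nu_{i+1,j}p.\,x(p))\,{}_i?_j\,(\nu_{i,j+1}p.\,y(p))$. Proposition (Extensionality for ground terms). Let $t$ and $u$ be terms without free parameters in the variable context $x_1:m_1,\dots,x_k:m_k$, that is, $-\mid x_1:m_1,\dots,x_k:m_k\vdash t,u$. Suppose that for all terms $v_1,\dots,v_k$ with $$p_1,\dots,p_{m_i}\mid y:0,\,z:0\vdash v_i\qquad(i=1,\dots,k)$$ the equation $$-\mid y:0,\,z:0\vdash t[v_1,\dots,v_k/x_1,\dots,x_k]=u[v_1,\dots,v_k/x_1,\dots,x_k]$$ is derivable, where $[v_1,\dots,v_k/x_1,\dots,x_k]$ is the simultaneous capture-avoiding substitution, which replaces each occurrence $x_i(q_1,\dots,q_{m_i})$ by $v_i$ with $q_1,\dots,q_{m_i}$ for $p_1,\dots,p_{m_i}$. Then $$-\mid x_1:m_1,\dots,x_k:m_k\vdash t=u$$ is derivable. -/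

import Mathlib

namespace BetaBernoulli

/-- `Term Δ ℓ` is the type of terms in parameter context `Γ = (p_0, …, p_{ℓ-1})` and variable context
`Δ = (x_0 : Δ 0, …, x_{k-1} : Δ (k-1))`. Parameters are referred to by their position in `Γ`, so that
terms are taken up to renaming of bound parameters. The binder `ν` appends its bound parameter at the
end of the parameter context: in the body of `nu`, a term over `ℓ + 1` parameters, the bound parameter
is `Fin.last ℓ`, and a parameter `p` of `Γ` is `p.castSucc`. -/
inductive Term {k : ℕ} (Δ : Fin k → ℕ) : ℕ → Type
  /-- The term `x_i(p_1, …, p_m)`, where `m = Δ i`. -/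
  | var {ℓ : ℕ} (i : Fin k) (ps : Fin (Δ i) → Fin ℓ) : Term Δ ℓ
  /-- The term `ν_{i,j} p. t`, where `i, j > 0`. -/
  | nu {ℓ : ℕ} (i j : ℕ) (hi : 0 < i) (hj : 0 < j) (t : Term Δ (ℓ + 1)) : Term Δ ℓ
  /-- The term `t ?_p u`. -/
  | pch {ℓ : ℕ} (p : Fin ℓ) (t u : Term Δ ℓ) : Term Δ ℓ
  /-- The term `t _i?_j u`, where `i + j > 0`. -/
  | rch {ℓ : ℕ} (i j : ℕ) (h : 0 < i + j) (t u : Term Δ ℓ) : Term Δ ℓ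

/-- Extend a map of parameters under a binder: the bound parameter is sent to the bound parameter. -/
def liftRen {ℓ ℓ' : ℕ} (ρ : Fin ℓ → Fin ℓ') : Fin (ℓ + 1) → Fin (ℓ' + 1) :=
  Fin.snoc (α := fun _ => Fin (ℓ' + 1)) (fun p => (ρ p).castSucc) (Fin.last ℓ')

namespace Term

/-- Capture-avoiding substitution of parameters for the free parameters of a term. -/
def rename {k : ℕ} {Δ : Fin k → ℕ} : {ℓ : ℕ} → Term Δ ℓ → {ℓ' : ℕ} → (Fin ℓ → Fin ℓ') → Term Δ ℓ'
  | _, var i ps, _, ρ => var i (fun a => ρ (ps a))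
  | _, nu i j hi hj t, _, ρ => nu i j hi hj (t.rename (liftRen ρ))
  | _, pch p t u, _, ρ => pch (ρ p) (t.rename ρ) (u.rename ρ)
  | _, rch i j h t u, _, ρ => rch i j h (t.rename ρ) (u.rename ρ)

/-- Capture-avoiding simultaneous substitution `t[v_0 … v_{k-1} / x_0 … x_{k-1}]` of terms for
variables. If `x_i` expects `m = Δ i` parameters, then the term `v_i` lives in the parameter context
`(p_1, …, p_m, Γ)`; its first `m` parameters are the formal parameters, which are replaced by the actual
parameters of each occurrence of `x_i`, and the remaining ones are the free parameters of `Γ`. When `Γ`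
is empty, `v_i` is thus a term over exactly `p_1, …, p_m`. Under a binder, `v_i` is weakened by the
bound parameter. -/
def subst {k k' : ℕ} {Δ : Fin k → ℕ} {Δ' : Fin k' → ℕ} :
    {ℓ : ℕ} → Term Δ ℓ → ((i : Fin k) → Term Δ' (Δ i + ℓ)) → Term Δ' ℓ
  | _, var i ps, v => (v i).rename (Fin.append ps id)
  | _, nu i j hi hj t, v => nu i j hi hj (t.subst fun a => (v a).rename Fin.castSucc)
  | _, pch p t u, v => pch p (t.subst v) (u.subst v)
  | _, rch i j h t u, v => rch i j h (t.subst v) (u.subst v)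

end Term

/-- The variable context with `k` variables, each of which expects `m` parameters. -/
abbrev Ctx (k m : ℕ) : Fin k → ℕ := fun _ => m

/-- The variable context `(y, z : 0)`, that of ground terms. -/
abbrev Ground : Fin 2 → ℕ := Ctx 2 0

open Term in
/-- The axioms, each in the context in which it is stated. Variables `w, x, y, z` are numbered in the
order in which they are listed; likewise parameters, with bound parameters numbered after free ones. -/
inductive Axiom : {k : ℕ} → {Δ : Fin k → ℕ} → {ℓ : ℕ} → Term Δ ℓ → Term Δ ℓ → Prop
  /-- `w,x,y,z:0 ⊢ (w _i?_j x) _{i+j}?_{k+l} (y _k?_l z) = (w _i?_k y) _{i+k}?_{j+l} (x _j?_l z)` -/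
  | interchange (i j k l : ℕ)
      (hij : 0 < i + j) (hkl : 0 < k + l) (hik : 0 < i + k) (hjl : 0 < j + l) :
      Axiom (Δ := Ctx 4 0) (ℓ := 0)
        (rch (i + j) (k + l) (by omega)
          (rch i j hij (var 0 ![]) (var 1 ![])) (rch k l hkl (var 2 ![]) (var 3 ![])))
        (rch (i + k) (j + l) (by omega)
          (rch i k hik (var 0 ![]) (var 2 ![])) (rch j l hjl (var 1 ![]) (var 3 ![])))
  /-- `x,y:0 ⊢ x _i?_j y = y _j?_i x` -/
  | rch_symm (i j : ℕ) (h : 0 < i + j) :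
      Axiom (Δ := Ctx 2 0) (ℓ := 0)
        (rch i j h (var 0 ![]) (var 1 ![]))
        (rch j i (by omega) (var 1 ![]) (var 0 ![]))
  /-- `x,y:0 ⊢ x _i?_0 y = x` -/
  | rch_zero (i : ℕ) (h : 0 < i) :
      Axiom (Δ := Ctx 2 0) (ℓ := 0)
        (rch i 0 (by omega) (var 0 ![]) (var 1 ![]))
        (var 0 ![])
  /-- `x:0 ⊢ x _i?_j x = x` -/
  | rch_self (i j : ℕ) (h : 0 < i + j) :
      Axiom (Δ := Ctx 1 0) (ℓ := 0)
        (rch i j h (var 0 ![]) (var 0 ![]))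
        (var 0 ![])
  /-- `p,q | w,x,y,z:0 ⊢ (w ?_q x) ?_p (y ?_q z) = (w ?_p y) ?_q (x ?_p z)` -/
  | comm_pch_pch :
      Axiom (Δ := Ctx 4 0) (ℓ := 2)
        (pch 0 (pch 1 (var 0 ![]) (var 1 ![])) (pch 1 (var 2 ![]) (var 3 ![])))
        (pch 1 (pch 0 (var 0 ![]) (var 2 ![])) (pch 0 (var 1 ![]) (var 3 ![])))
  /-- `- | x:2 ⊢ ν_{i,j}p. (ν_{k,l}q. x(p,q)) = ν_{k,l}q. (ν_{i,j}p. x(p,q))` -/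
  | comm_nu_nu (i j k l : ℕ) (hi : 0 < i) (hj : 0 < j) (hk : 0 < k) (hl : 0 < l) :
      Axiom (Δ := Ctx 1 2) (ℓ := 0)
        (nu i j hi hj (nu k l hk hl (var 0 ![0, 1])))
        (nu k l hk hl (nu i j hi hj (var 0 ![1, 0])))
  /-- `q | x,y:1 ⊢ ν_{i,j}p. (x(p) ?_q y(p)) = (ν_{i,j}p. x(p)) ?_q (ν_{i,j}p. y(p))` -/
  | comm_nu_pch (i j : ℕ) (hi : 0 < i) (hj : 0 < j) :
      Axiom (Δ := Ctx 2 1) (ℓ := 1)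
        (nu i j hi hj (pch 0 (var 0 ![1]) (var 1 ![1])))
        (pch 0 (nu i j hi hj (var 0 ![1])) (nu i j hi hj (var 1 ![1])))
  /-- `- | x,y:1 ⊢ ν_{i,j}p. (x(p) _k?_l y(p)) = (ν_{i,j}p. x(p)) _k?_l (ν_{i,j}p. y(p))` -/
  | comm_nu_rch (i j k l : ℕ) (hi : 0 < i) (hj : 0 < j) (hkl : 0 < k + l) :
      Axiom (Δ := Ctx 2 1) (ℓ := 0)
        (nu i j hi hj (rch k l hkl (var 0 ![0]) (var 1 ![0])))
        (rch k l hkl (nu i j hi hj (var 0 ![0])) (nu i j hi hj (var 1 ![0])))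
  /-- `p | w,x,y,z:0 ⊢ (w _i?_j x) ?_p (y _i?_j z) = (w ?_p y) _i?_j (x ?_p z)` -/
  | comm_pch_rch (i j : ℕ) (h : 0 < i + j) :
      Axiom (Δ := Ctx 4 0) (ℓ := 1)
        (pch 0 (rch i j h (var 0 ![]) (var 1 ![])) (rch i j h (var 2 ![]) (var 3 ![])))
        (rch i j h (pch 0 (var 0 ![]) (var 2 ![])) (pch 0 (var 1 ![]) (var 3 ![])))
  /-- `- | x:0 ⊢ (ν_{i,j}p. x) = x` -/
  | discard_nu (i j : ℕ) (hi : 0 < i) (hj : 0 < j) :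
      Axiom (Δ := Ctx 1 0) (ℓ := 0)
        (nu i j hi hj (var 0 ![]))
        (var 0 ![])
  /-- `p | x:0 ⊢ x ?_p x = x` -/
  | discard_pch :
      Axiom (Δ := Ctx 1 0) (ℓ := 1)
        (pch 0 (var 0 ![]) (var 0 ![]))
        (var 0 ![])
  /-- `- | x,y:1 ⊢ ν_{i,j}p. (x(p) ?_p y(p)) = (ν_{i+1,j}p. x(p)) _i?_j (ν_{i,j+1}p. y(p))` -/
  | conjugacy (i j : ℕ) (hi : 0 < i) (hj : 0 < j) :
      Axiom (Δ := Ctx 2 1) (ℓ := 0)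
        (nu i j hi hj (pch 0 (var 0 ![0]) (var 1 ![0])))
        (rch i j (by omega)
          (nu (i + 1) j (by omega) hj (var 0 ![0]))
          (nu i (j + 1) hi (by omega) (var 1 ![0])))

/-- Derivable equality `Γ | Δ ⊢ t = u`: the closure of the axioms under substitution (of parameters for
parameters, and of terms for variables), congruence, reflexivity, symmetry and transitivity. -/
inductive Derivable : {k : ℕ} → {Δ : Fin k → ℕ} → {ℓ : ℕ} → Term Δ ℓ → Term Δ ℓ → Prop
  | ax {k : ℕ} {Δ : Fin k → ℕ} {ℓ : ℕ} {t u : Term Δ ℓ} : Axiom t u → Derivable t u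
  | substitution {k k' : ℕ} {Δ : Fin k → ℕ} {Δ' : Fin k' → ℕ} {ℓ ℓ' : ℕ} {t u : Term Δ ℓ}
      (ρ : Fin ℓ → Fin ℓ') (v : (i : Fin k) → Term Δ' (Δ i + ℓ')) :
      Derivable t u → Derivable ((t.rename ρ).subst v) ((u.rename ρ).subst v)
  | nu_congr {k : ℕ} {Δ : Fin k → ℕ} {ℓ : ℕ} (i j : ℕ) (hi : 0 < i) (hj : 0 < j)
      {t t' : Term Δ (ℓ + 1)} :
      Derivable t t' → Derivable (Term.nu i j hi hj t) (Term.nu i j hi hj t')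
  | pch_congr {k : ℕ} {Δ : Fin k → ℕ} {ℓ : ℕ} (p : Fin ℓ) {t t' u u' : Term Δ ℓ} :
      Derivable t t' → Derivable u u' → Derivable (Term.pch p t u) (Term.pch p t' u')
  | rch_congr {k : ℕ} {Δ : Fin k → ℕ} {ℓ : ℕ} (i j : ℕ) (h : 0 < i + j) {t t' u u' : Term Δ ℓ} :
      Derivable t t' → Derivable u u' → Derivable (Term.rch i j h t u) (Term.rch i j h t' u')
  | refl {k : ℕ} {Δ : Fin k → ℕ} {ℓ : ℕ} (t : Term Δ ℓ) : Derivable t t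
  | symm {k : ℕ} {Δ : Fin k → ℕ} {ℓ : ℕ} {t u : Term Δ ℓ} : Derivable t u → Derivable u t
  | trans {k : ℕ} {Δ : Fin k → ℕ} {ℓ : ℕ} {t u w : Term Δ ℓ} :
      Derivable t u → Derivable u w → Derivable t w

end BetaBernoulli

/-! Every closed term has a normal form, and ground substitutions suffice to read it off. Conjugacy
turns each choice `?_p` under its binder into a rational choice that updates the indices of `p`.
Every closed term is thereby a rational mixture of terms `ν…ν. x(…)`. Read from right to left, `x
?_p x = x` followed by conjugacy raises index sums one at a time, so all index sums can be brought
to a common level. Unused parameters are discarded and binders commute. Hence closed terms `t` and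
`u` are uniform mixtures of finite lists of canonical atoms of one common level `N`
(`exists_isMix_close`, `exists_eq_mix`).

Soundness comes from the beta-Bernoulli model: `ν_{i,j}` integrates against the beta density on
`[0,1]`, and choices are convex combinations (`Derivable.sem_eq`). With `y = 1` and `z = 0`, ground
terms define enough polynomials to span all polynomials. The hypothesis thus makes the normal forms
of `t` and `u` agree as linear functionals on polynomials.

These functionals are linearly independent (`Pattern.val_independent`). A squared separating
polynomial isolates the finest identification of arguments that occurs; positivity of the integral
of a square then reduces the claim to the independence of beta densities of fixed total degree. So
each atom has the same relative frequency in both lists. After replication the lists are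
permutations of each other, and a mixture does not depend on the order of its list. -/

namespace BetaBernoulli

/-! ### Laws of renaming and substitution. -/

theorem liftRen_castSucc {ℓ ℓ' : ℕ} (ρ : Fin ℓ → Fin ℓ') (p : Fin ℓ) :
    liftRen ρ p.castSucc = (ρ p).castSucc := by
  simp [liftRen]

theorem liftRen_last {ℓ ℓ' : ℕ} (ρ : Fin ℓ → Fin ℓ') :
    liftRen ρ (Fin.last ℓ) = Fin.last ℓ' := by
  simp [liftRen]

theorem liftRen_comp {ℓ ℓ' ℓ'' : ℕ} (ρ : Fin ℓ → Fin ℓ') (ρ' : Fin ℓ' → Fin ℓ'') :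
    liftRen ρ' ∘ liftRen ρ = liftRen (ρ' ∘ ρ) := by
  funext p
  refine Fin.lastCases ?_ (fun p => ?_) p <;> simp [liftRen_castSucc, liftRen_last]

theorem liftRen_id {ℓ : ℕ} : liftRen (id : Fin ℓ → Fin ℓ) = id := by
  funext p
  refine Fin.lastCases ?_ (fun p => ?_) p <;> simp [liftRen_castSucc, liftRen_last]

namespace Term

variable {k k' : ℕ} {Δ : Fin k → ℕ} {Δ' : Fin k' → ℕ}

theorem rename_rename {ℓ : ℕ} (t : Term Δ ℓ) :
    ∀ {ℓ' ℓ'' : ℕ} (ρ : Fin ℓ → Fin ℓ') (ρ' : Fin ℓ' → Fin ℓ''),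
      (t.rename ρ).rename ρ' = t.rename (ρ' ∘ ρ) := by
  induction t with
  | var i ps => intros; rfl
  | nu i j hi hj t ih => intros; simp only [rename, ih, liftRen_comp]
  | pch p t u iht ihu => intros; simp only [rename, iht, ihu, Function.comp_apply]
  | rch i j h t u iht ihu => intros; simp only [rename, iht, ihu]

theorem rename_id {ℓ : ℕ} (t : Term Δ ℓ) : t.rename id = t := by
  induction t with
  | var i ps => rfl
  | nu i j hi hj t ih => simp only [rename, liftRen_id, ih]
  | pch p t u iht ihu => simp only [rename, iht, ihu, id]
  | rch i j h t u iht ihu => simp only [rename, iht, ihu]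

theorem rename_eq_self {ℓ : ℕ} (t : Term Δ ℓ) {ρ : Fin ℓ → Fin ℓ} (h : ρ = id) :
    t.rename ρ = t := by
  rw [h, rename_id]

theorem subst_var {ℓ : ℕ} (t : Term Δ ℓ) :
    t.subst (fun i => var i (Fin.castAdd ℓ)) = t := by
  induction t with
  | var i ps => simp only [subst, rename]; congr 1; funext a; simp
  | nu i j hi hj t ih => simp only [subst, rename]; congr 1
  | pch p t u iht ihu => simp only [subst, iht, ihu]
  | rch i j h t u iht ihu => simp only [subst, iht, ihu]

end Term

theorem Derivable.rename {k : ℕ} {Δ : Fin k → ℕ} {ℓ ℓ' : ℕ} {t u : Term Δ ℓ}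
    (h : Derivable t u) (ρ : Fin ℓ → Fin ℓ') : Derivable (t.rename ρ) (u.rename ρ) := by
  simpa only [Term.subst_var] using
    Derivable.substitution ρ (fun i => Term.var i (Fin.castAdd ℓ')) h

/-! ### The algebra of terms modulo derivable equality. -/

/-- Terms up to derivable equality. -/
def termSetoid {k : ℕ} (Δ : Fin k → ℕ) (ℓ : ℕ) : Setoid (Term Δ ℓ) where
  r := Derivable
  iseqv := ⟨Derivable.refl, Derivable.symm, Derivable.trans⟩

/-- The free algebra: terms modulo derivable equality. -/
def Alg {k : ℕ} (Δ : Fin k → ℕ) (ℓ : ℕ) : Type := Quotient (termSetoid Δ ℓ)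

namespace Alg

variable {k : ℕ} {Δ : Fin k → ℕ} {ℓ ℓ' ℓ'' : ℕ}

/-- The class of a term. -/
def mk (t : Term Δ ℓ) : Alg Δ ℓ := Quotient.mk (termSetoid Δ ℓ) t

theorem mk_eq_mk {t u : Term Δ ℓ} : mk t = mk u ↔ Derivable t u :=
  ⟨fun h => Quotient.exact h, fun h => Quotient.sound h⟩

/-- The class of a variable. -/
def var (i : Fin k) (ps : Fin (Δ i) → Fin ℓ) : Alg Δ ℓ := mk (Term.var i ps)

/-- The operation `ν_{i+1,j+1}` on classes. -/
def nu (I : ℕ × ℕ) : Alg Δ (ℓ + 1) → Alg Δ ℓ :=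
  Quotient.map' (fun t => Term.nu (I.1 + 1) (I.2 + 1) (Nat.succ_pos _) (Nat.succ_pos _) t)
    (fun _ _ h => Derivable.nu_congr _ _ _ _ h)

/-- The operation `?_p` on classes. -/
def pch (p : Fin ℓ) : Alg Δ ℓ → Alg Δ ℓ → Alg Δ ℓ :=
  Quotient.map₂ (fun t u => Term.pch p t u)
    (fun _ _ h _ _ h' => Derivable.pch_congr p h h')

/-- The operation `_i?_j` on classes, extended by the first projection to `i = j = 0`. -/
def conv (i j : ℕ) (a b : Alg Δ ℓ) : Alg Δ ℓ :=
  if h : 0 < i + j then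
    Quotient.map₂ (fun t u => Term.rch i j h t u)
      (fun _ _ h₁ _ _ h₂ => Derivable.rch_congr i j h h₁ h₂) a b
  else a

/-- Renaming of parameters on classes. -/
def rename (ρ : Fin ℓ → Fin ℓ') : Alg Δ ℓ → Alg Δ ℓ' :=
  Quotient.map' (fun t => t.rename ρ) (fun _ _ h => h.rename ρ)

theorem ind {P : Alg Δ ℓ → Prop} (h : ∀ t, P (mk t)) (a : Alg Δ ℓ) : P a :=
  Quotient.ind h a

theorem nu_mk (I : ℕ × ℕ) (t : Term Δ (ℓ + 1)) :
    nu I (mk t) = mk (Term.nu (I.1 + 1) (I.2 + 1) (Nat.succ_pos _) (Nat.succ_pos _) t) := rfl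

theorem pch_mk (p : Fin ℓ) (t u : Term Δ ℓ) : pch p (mk t) (mk u) = mk (Term.pch p t u) := rfl

theorem conv_mk {i j : ℕ} (h : 0 < i + j) (t u : Term Δ ℓ) :
    conv i j (mk t) (mk u) = mk (Term.rch i j h t u) := by
  exact dif_pos h

theorem rename_mk (ρ : Fin ℓ → Fin ℓ') (t : Term Δ ℓ) : rename ρ (mk t) = mk (t.rename ρ) := rfl

theorem rename_rename (ρ : Fin ℓ → Fin ℓ') (ρ' : Fin ℓ' → Fin ℓ'') (a : Alg Δ ℓ) :
    rename ρ' (rename ρ a) = rename (ρ' ∘ ρ) a := by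
  induction a using ind with
  | h t => simp only [rename_mk, Term.rename_rename]

theorem rename_eq_self {ρ : Fin ℓ → Fin ℓ} (h : ρ = id) (a : Alg Δ ℓ) : rename ρ a = a := by
  induction a using ind with
  | h t => simp only [rename_mk, Term.rename_eq_self t h]

theorem rename_nu (ρ : Fin ℓ → Fin ℓ') (I : ℕ × ℕ) (a : Alg Δ (ℓ + 1)) :
    rename ρ (nu I a) = nu I (rename (liftRen ρ) a) := by
  induction a using ind with
  | h t => rfl

theorem rename_var (ρ : Fin ℓ → Fin ℓ') (i : Fin k) (ps : Fin (Δ i) → Fin ℓ) :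
    rename ρ (var i ps) = var i (ρ ∘ ps) := rfl

/-! ### The axioms as identities between arbitrary classes. -/

/-- The term to be substituted for a variable without arguments. -/
def constArg (t : Term Δ ℓ) : Term Δ (0 + ℓ) := t.rename (Fin.natAdd 0)

theorem constArg_rename (t : Term Δ ℓ) (f : Fin 0 → Fin ℓ') (g : Fin ℓ → Fin ℓ') :
    (constArg t).rename (Fin.append f g) = t.rename g := by
  rw [constArg, Term.rename_rename]
  congr 1
  funext p
  exact Fin.append_right f g p

/-- The term to be substituted for a variable with one argument, which is the last parameter. -/
def unaryArg (t : Term Δ (ℓ + 1)) : Term Δ (1 + ℓ) :=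
  t.rename (Fin.snoc (α := fun _ => Fin (1 + ℓ)) (Fin.natAdd 1) 0)

theorem unaryArg_rename (t : Term Δ (ℓ + 1)) (f : Fin 1 → Fin ℓ') (g : Fin ℓ → Fin ℓ') :
    (unaryArg t).rename (Fin.append f g) =
      t.rename (Fin.snoc (α := fun _ => Fin ℓ') g (f 0)) := by
  rw [unaryArg, Term.rename_rename]
  congr 1
  funext p
  refine Fin.lastCases ?_ (fun p => ?_) p
  · simp only [Function.comp_apply, Fin.snoc_last]
    exact Fin.append_left f g 0
  · simp

/-- The term to be substituted for a variable with two arguments, which are the last parameters. -/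
def binaryArg (t : Term Δ (ℓ + 1 + 1)) : Term Δ (2 + ℓ) :=
  t.rename (Fin.snoc (α := fun _ => Fin (2 + ℓ))
    (Fin.snoc (α := fun _ => Fin (2 + ℓ)) (Fin.natAdd 2) (Fin.castAdd ℓ 0)) (Fin.castAdd ℓ 1))

theorem binaryArg_rename (t : Term Δ (ℓ + 1 + 1)) (f : Fin 2 → Fin ℓ') (g : Fin ℓ → Fin ℓ') :
    (binaryArg t).rename (Fin.append f g) =
      t.rename (Fin.snoc (α := fun _ => Fin ℓ') (Fin.snoc (α := fun _ => Fin ℓ') g (f 0)) (f 1)) := by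
  rw [binaryArg, Term.rename_rename]
  congr 1
  funext p
  refine Fin.lastCases ?_ (fun p => Fin.lastCases ?_ (fun p => ?_) p) p
  · simp only [Function.comp_apply, Fin.snoc_last]
    exact Fin.append_left f g 1
  · simp only [Function.comp_apply, Fin.snoc_last, Fin.snoc_castSucc]
    exact Fin.append_left f g 0
  · simp

theorem conv_interchange {i j k' l : ℕ} (hij : 0 < i + j) (hkl : 0 < k' + l) (hik : 0 < i + k')
    (hjl : 0 < j + l) (w x y z : Alg Δ ℓ) :
    conv (i + j) (k' + l) (conv i j w x) (conv k' l y z) =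
      conv (i + k') (j + l) (conv i k' w y) (conv j l x z) := by
  induction w using ind with | h w
  induction x using ind with | h x
  induction y using ind with | h y
  induction z using ind with | h z
  -- The axiom lives in the empty parameter context; `Fin.elim0` weakens it to `ℓ` parameters before
  -- its variables are instantiated.
  have := Derivable.substitution Fin.elim0
    (![constArg w, constArg x, constArg y, constArg z] : (i : Fin 4) → Term Δ (Ctx 4 0 i + ℓ))
    (Derivable.ax (Axiom.interchange i j k' l hij hkl hik hjl))
  simp only [Term.rename, Term.subst] at this
  rw [conv_mk hij, conv_mk hkl, conv_mk hik, conv_mk hjl, conv_mk (by omega), conv_mk (by omega),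
    mk_eq_mk]
  simpa only [Matrix.cons_val, constArg_rename, Term.rename_id] using this

theorem conv_symm {i j : ℕ} (h : 0 < i + j) (x y : Alg Δ ℓ) : conv i j x y = conv j i y x := by
  induction x using ind with | h x
  induction y using ind with | h y
  have := Derivable.substitution Fin.elim0
    (![constArg x, constArg y] : (i : Fin 2) → Term Δ (Ctx 2 0 i + ℓ))
    (Derivable.ax (Axiom.rch_symm i j h))
  simp only [Term.rename, Term.subst] at this
  rw [conv_mk h, conv_mk (by omega), mk_eq_mk]
  simpa only [Matrix.cons_val, constArg_rename, Term.rename_id] using this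

theorem conv_zero {i : ℕ} (h : 0 < i) (x y : Alg Δ ℓ) : conv i 0 x y = x := by
  induction x using ind with | h x
  induction y using ind with | h y
  have := Derivable.substitution Fin.elim0
    (![constArg x, constArg y] : (i : Fin 2) → Term Δ (Ctx 2 0 i + ℓ))
    (Derivable.ax (Axiom.rch_zero i h))
  simp only [Term.rename, Term.subst] at this
  rw [conv_mk (by omega), mk_eq_mk]
  simpa only [Matrix.cons_val, constArg_rename, Term.rename_id] using this

theorem conv_self {i j : ℕ} (h : 0 < i + j) (x : Alg Δ ℓ) : conv i j x x = x := by
  induction x using ind with | h x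
  have := Derivable.substitution Fin.elim0
    (![constArg x] : (i : Fin 1) → Term Δ (Ctx 1 0 i + ℓ))
    (Derivable.ax (Axiom.rch_self i j h))
  simp only [Term.rename, Term.subst] at this
  rw [conv_mk h, mk_eq_mk]
  simpa only [Matrix.cons_val, Matrix.cons_val_fin_one, constArg_rename, Term.rename_id] using this

theorem pch_self (p : Fin ℓ) (x : Alg Δ ℓ) : pch p x x = x := by
  induction x using ind with | h x
  have := Derivable.substitution (fun _ => p)
    (![constArg x] : (i : Fin 1) → Term Δ (Ctx 1 0 i + ℓ))
    (Derivable.ax Axiom.discard_pch)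
  simp only [Term.rename, Term.subst] at this
  rw [pch_mk, mk_eq_mk]
  simpa only [Matrix.cons_val, Matrix.cons_val_fin_one, constArg_rename, Term.rename_id] using this

theorem nu_weaken (I : ℕ × ℕ) (x : Alg Δ ℓ) : nu I (rename Fin.castSucc x) = x := by
  induction x using ind with | h x
  have := Derivable.substitution Fin.elim0
    (![constArg x] : (i : Fin 1) → Term Δ (Ctx 1 0 i + ℓ))
    (Derivable.ax (Axiom.discard_nu (I.1 + 1) (I.2 + 1) (Nat.succ_pos _) (Nat.succ_pos _)))
  simp only [Term.rename, Term.subst, Matrix.cons_val_fin_one] at this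
  rw [rename_mk, nu_mk, mk_eq_mk]
  convert this using 1
  · congr 1
    rw [constArg, Term.rename_rename, Term.rename_rename]
    congr 1
    funext p
    have : (p.natAdd 0).castSucc = Fin.natAdd 0 p.castSucc := rfl
    simp only [Function.comp_apply]
    rw [this]
    exact (Fin.append_right (m := 0) (n := ℓ + 1) _ id p.castSucc).symm
  · rw [constArg_rename, Term.rename_id]

theorem append_comp_castSucc {m ℓ ℓ' : ℕ} (f : Fin m → Fin ℓ') (g : Fin (ℓ + 1) → Fin ℓ') :
    (Fin.append f g : Fin (m + (ℓ + 1)) → Fin ℓ') ∘ (Fin.castSucc : Fin (m + ℓ) → Fin (m + ℓ + 1)) =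
      Fin.append f (g ∘ Fin.castSucc) := by
  funext p
  refine Fin.addCases (fun p => ?_) (fun p => ?_) p
  · have : (Fin.castAdd ℓ p).castSucc = Fin.castAdd (ℓ + 1) p := rfl
    simp only [Function.comp_apply, Fin.append_left]
    rw [this]
    exact Fin.append_left _ _ _
  · have : (Fin.natAdd m p).castSucc = Fin.natAdd m p.castSucc := rfl
    simp only [Function.comp_apply, Fin.append_right]
    rw [this]
    exact Fin.append_right _ _ _

theorem unaryArg_rename_castSucc (x : Term Δ (ℓ + 1)) (f : Fin 1 → Fin (ℓ + 1))
    (hf : f 0 = Fin.last ℓ) :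
    ((unaryArg x).rename Fin.castSucc).rename
      (Fin.append f id : Fin (1 + (ℓ + 1)) → Fin (ℓ + 1)) = x := by
  rw [Term.rename_rename, append_comp_castSucc, unaryArg_rename, hf]
  refine Term.rename_eq_self _ ?_
  funext p
  refine Fin.lastCases ?_ (fun p => ?_) p <;> simp

theorem nu_conv (I : ℕ × ℕ) {i j : ℕ} (h : 0 < i + j) (x y : Alg Δ (ℓ + 1)) :
    nu I (conv i j x y) = conv i j (nu I x) (nu I y) := by
  induction x using ind with | h x
  induction y using ind with | h y
  have := Derivable.substitution Fin.elim0
    (![unaryArg x, unaryArg y] : (i : Fin 2) → Term Δ (Ctx 2 1 i + ℓ))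
    (Derivable.ax (Axiom.comm_nu_rch (I.1 + 1) (I.2 + 1) i j (Nat.succ_pos _) (Nat.succ_pos _) h))
  simp only [Term.rename, Term.subst] at this
  rw [nu_mk, nu_mk, conv_mk h, conv_mk h, nu_mk, mk_eq_mk]
  simp only [Matrix.cons_val] at this
  rw [unaryArg_rename_castSucc x, unaryArg_rename_castSucc y] at this
  · exact this
  all_goals exact liftRen_last _

theorem nu_pch_castSucc (I : ℕ × ℕ) (p : Fin ℓ) (x y : Alg Δ (ℓ + 1)) :
    nu I (pch p.castSucc x y) = pch p (nu I x) (nu I y) := by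
  induction x using ind with | h x
  induction y using ind with | h y
  have := Derivable.substitution (fun _ => p)
    (![unaryArg x, unaryArg y] : (i : Fin 2) → Term Δ (Ctx 2 1 i + ℓ))
    (Derivable.ax (Axiom.comm_nu_pch (I.1 + 1) (I.2 + 1) (Nat.succ_pos _) (Nat.succ_pos _)))
  simp only [Term.rename, Term.subst] at this
  rw [nu_mk, nu_mk, pch_mk, pch_mk, nu_mk, mk_eq_mk]
  simp only [Matrix.cons_val] at this
  rw [unaryArg_rename_castSucc x, unaryArg_rename_castSucc y] at this
  · have h0 : liftRen (fun _ : Fin 1 => p) 0 = p.castSucc := liftRen_castSucc _ 0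
    rwa [h0] at this
  all_goals exact liftRen_last _

theorem nu_pch_last (I : ℕ × ℕ) (x y : Alg Δ (ℓ + 1)) :
    nu I (pch (Fin.last ℓ) x y) =
      conv (I.1 + 1) (I.2 + 1) (nu (I.1 + 1, I.2) x) (nu (I.1, I.2 + 1) y) := by
  induction x using ind with | h x
  induction y using ind with | h y
  have := Derivable.substitution Fin.elim0
    (![unaryArg x, unaryArg y] : (i : Fin 2) → Term Δ (Ctx 2 1 i + ℓ))
    (Derivable.ax (Axiom.conjugacy (I.1 + 1) (I.2 + 1) (Nat.succ_pos _) (Nat.succ_pos _)))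
  simp only [Term.rename, Term.subst] at this
  rw [nu_mk, nu_mk, pch_mk, conv_mk (by omega), nu_mk, mk_eq_mk]
  simp only [Matrix.cons_val] at this
  rw [unaryArg_rename_castSucc x, unaryArg_rename_castSucc y] at this
  · have h0 : liftRen (Fin.elim0 : Fin 0 → Fin ℓ) 0 = Fin.last ℓ := liftRen_last _
    rwa [h0] at this
  all_goals exact liftRen_last _

/-- The exchange of the last two parameters. -/
def swapLast (ℓ : ℕ) : Fin (ℓ + 1 + 1) → Fin (ℓ + 1 + 1) :=
  Fin.snoc (α := fun _ => Fin (ℓ + 1 + 1))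
    (Fin.snoc (α := fun _ => Fin (ℓ + 1 + 1)) (fun p => p.castSucc.castSucc) (Fin.last (ℓ + 1)))
    (Fin.last ℓ).castSucc

theorem nu_nu (I J : ℕ × ℕ) (x : Alg Δ (ℓ + 1 + 1)) :
    nu I (nu J x) = nu J (nu I (rename (swapLast ℓ) x)) := by
  induction x using ind with | h x
  have := Derivable.substitution Fin.elim0
    (![binaryArg x] : (i : Fin 1) → Term Δ (Ctx 1 2 i + ℓ))
    (Derivable.ax (Axiom.comm_nu_nu (I.1 + 1) (I.2 + 1) (J.1 + 1) (J.2 + 1) (Nat.succ_pos _)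
      (Nat.succ_pos _) (Nat.succ_pos _) (Nat.succ_pos _)))
  simp only [Term.rename, Term.subst, Matrix.cons_val_fin_one] at this
  simp only [rename_mk, nu_mk, mk_eq_mk]
  convert this using 3
  · rw [Term.rename_rename, append_comp_castSucc, Term.rename_rename, append_comp_castSucc,
      binaryArg_rename]
    refine (Term.rename_eq_self _ ?_).symm
    funext p
    refine Fin.lastCases ?_ (fun p => Fin.lastCases ?_ (fun p => ?_) p) p
    · simp
      exact liftRen_last _
    · simp
      exact (liftRen_castSucc _ (Fin.last 0)).trans (congrArg Fin.castSucc (liftRen_last _))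
    · simp
  · rw [Term.rename_rename, append_comp_castSucc, Term.rename_rename, append_comp_castSucc,
      binaryArg_rename]
    congr 1

/-! ### Rational convexity and uniform mixtures. -/

theorem conv_zero_left {j : ℕ} (h : 0 < j) (x y : Alg Δ ℓ) : conv 0 j x y = y := by
  rw [conv_symm (by omega), conv_zero h]

theorem conv_zero_zero (x y : Alg Δ ℓ) : conv 0 0 x y = x := rfl

theorem conv_assoc {i j l : ℕ} (hi : 0 < i) (hj : 0 < j) (x y z : Alg Δ ℓ) :
    conv i (j + l) x (conv j l y z) = conv (i + j) l (conv i j x y) z := by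
  rcases Nat.eq_zero_or_pos l with rfl | hl
  · rw [conv_zero hj, conv_zero (by omega), Nat.add_zero]
  -- Interchange with one weight zero is associativity; the second argument `z` is only a filler for
  -- the branch of weight zero.
  · have := conv_interchange (i := i) (j := 0) (k' := j) (l := l) (by omega) (by omega) (by omega)
      (by omega) x z y z
    rwa [conv_zero hi, conv_zero_left hl, Nat.add_zero, Nat.zero_add] at this

theorem conv_left_comm {i j l : ℕ} (hi : 0 < i) (hj : 0 < j) (x y z : Alg Δ ℓ) :
    conv i (j + l) x (conv j l y z) = conv j (i + l) y (conv i l x z) := by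
  rw [conv_assoc hi hj, conv_assoc hj hi, conv_symm (by omega) x y, Nat.add_comm]

theorem conv_scale {c i j : ℕ} (hc : 0 < c) (h : 0 < i + j) (x y : Alg Δ ℓ) :
    conv (c * i) (c * j) x y = conv i j x y := by
  rcases Nat.eq_zero_or_pos i with rfl | hi
  · rw [Nat.mul_zero, conv_zero_left (Nat.mul_pos hc (by omega)), conv_zero_left (by omega)]
  rcases Nat.eq_zero_or_pos j with rfl | hj
  · rw [Nat.mul_zero, conv_zero (Nat.mul_pos hc (by omega)), conv_zero (by omega)]
  induction c, hc using Nat.le_induction with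
  | base => rw [Nat.one_mul, Nat.one_mul]
  | succ c hc ih =>
    have hci : 0 < c * i := Nat.mul_pos hc hi
    -- Interchange splits the weights `(c+1)i` and `(c+1)j` into a `c`-fold part and a single part,
    -- which are equal by induction.
    have := conv_interchange (i := c * i) (j := i) (k' := c * j) (l := j) (by omega) (by omega)
      (by omega) (by omega) x x y y
    rw [conv_self (by omega), conv_self (by omega), ih, conv_self (by omega)] at this
    rw [Nat.add_mul, Nat.add_mul, Nat.one_mul, Nat.one_mul, this]

/-- The uniform mixture of a list, with value `d` for the empty list. -/
def mix (d : Alg Δ ℓ) : List (Alg Δ ℓ) → Alg Δ ℓ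
  | [] => d
  | a :: l => conv 1 l.length a (mix d l)

theorem mix_singleton (d a : Alg Δ ℓ) : mix d [a] = a := conv_zero one_pos _ _

theorem mix_perm (d : Alg Δ ℓ) {l l' : List (Alg Δ ℓ)} (h : l.Perm l') : mix d l = mix d l' := by
  induction h with
  | nil => rfl
  | cons a h ih => simp only [mix, ih, h.length_eq]
  | swap a b l =>
    simp only [mix, List.length_cons, Nat.add_comm l.length 1]
    rw [conv_left_comm one_pos one_pos]
  | trans _ _ ih ih' => rw [ih, ih']

theorem mix_append (d : Alg Δ ℓ) (l l' : List (Alg Δ ℓ)) :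
    mix d (l ++ l') = conv l.length l'.length (mix d l) (mix d l') := by
  induction l with
  | nil =>
    rcases Nat.eq_zero_or_pos l'.length with h | h
    · rw [List.length_eq_zero_iff] at h
      subst h
      rfl
    · exact (conv_zero_left h _ _).symm
  | cons a l ih =>
    rcases Nat.eq_zero_or_pos l.length with h | h
    · rw [List.length_eq_zero_iff] at h
      subst h
      rw [mix_singleton]
      rfl
    · simp only [List.cons_append, mix, ih, List.length_append, List.length_cons]
      rw [conv_assoc one_pos h, Nat.add_comm 1]

theorem mix_replicate (d : Alg Δ ℓ) {n : ℕ} (hn : 0 < n) (l : List (Alg Δ ℓ)) :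
    mix d (List.replicate n l).flatten = mix d l := by
  induction n, hn using Nat.le_induction with
  | base => simp
  | succ n hn ih =>
    rw [List.replicate_succ, List.flatten_cons, mix_append, ih]
    rcases Nat.eq_zero_or_pos l.length with h | h
    · simp [h, conv_zero_zero]
    · rw [conv_self (by omega)]

/-- Common denominators: the two replicated lists have lengths in the ratio `i : j`, and replication
does not change a mixture. -/
theorem conv_mix (d : Alg Δ ℓ) {i j : ℕ} (h : 0 < i + j) {l l' : List (Alg Δ ℓ)}
    (hl : l ≠ []) (hl' : l' ≠ []) :
    conv i j (mix d l) (mix d l') =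
      mix d ((List.replicate (i * l'.length) l).flatten ++
        (List.replicate (j * l.length) l').flatten) := by
  have h1 := List.length_pos_of_ne_nil hl
  have h2 := List.length_pos_of_ne_nil hl'
  rcases Nat.eq_zero_or_pos i with rfl | hi
  · rw [Nat.zero_mul, List.replicate_zero, List.flatten_nil, List.nil_append,
      mix_replicate d (Nat.mul_pos (by omega) h1), conv_zero_left (by omega)]
  rcases Nat.eq_zero_or_pos j with rfl | hj
  · rw [Nat.zero_mul, List.replicate_zero, List.flatten_nil, List.append_nil,
      mix_replicate d (Nat.mul_pos (by omega) h2), conv_zero (by omega)]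
  rw [mix_append, mix_replicate d (Nat.mul_pos hi h2), mix_replicate d (Nat.mul_pos hj h1)]
  have e1 : (List.replicate (i * l'.length) l).flatten.length = l.length * l'.length * i := by
    simp; ring
  have e2 : (List.replicate (j * l.length) l').flatten.length = l.length * l'.length * j := by
    simp; ring
  rw [e1, e2, conv_scale (Nat.mul_pos h1 h2) h]

/-! ### Closing a term by binding all its parameters. -/

/-- Binding all parameters, the parameter `a` by `ν` with indices `I a`. -/
def close : {ℓ : ℕ} → (Fin ℓ → ℕ × ℕ) → Alg Δ ℓ → Alg Δ 0
  | 0, _, x => x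
  | _ + 1, I, x => close (fun a => I a.castSucc) (nu (I (Fin.last _)) x)

theorem close_conv (I : Fin ℓ → ℕ × ℕ) {i j : ℕ} (h : 0 < i + j) (x y : Alg Δ ℓ) :
    close I (conv i j x y) = conv i j (close I x) (close I y) := by
  induction ℓ with
  | zero => rfl
  | succ ℓ ih => simp only [close, nu_conv _ h, ih]

/-- The choice commutes with the binders of the other parameters until it meets its own, where
conjugacy applies. This eliminates `?_p` from closed terms. -/
theorem close_pch (I : Fin ℓ → ℕ × ℕ) (p : Fin ℓ) (x y : Alg Δ ℓ) :
    close I (pch p x y) = conv ((I p).1 + 1) ((I p).2 + 1)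
      (close (Function.update I p ((I p).1 + 1, (I p).2)) x)
      (close (Function.update I p ((I p).1, (I p).2 + 1)) y) := by
  induction ℓ with
  | zero => exact p.elim0
  | succ ℓ ih =>
    refine Fin.lastCases ?_ (fun p => ?_) p
    · simp only [close, nu_pch_last]
      rw [close_conv _ (by omega)]
      simp
    · simp only [close, nu_pch_castSucc, ih]
      have key : ∀ z, (fun a : Fin ℓ => Function.update I p.castSucc z a.castSucc) =
          Function.update (fun a => I a.castSucc) p z := by
        intro z
        funext a
        by_cases h : a = p
        · subst h; simp
        · rw [Function.update_of_ne h, Function.update_of_ne]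
          simpa using h
      simp only [key, Function.update_of_ne (Fin.castSucc_ne_last p).symm]

/-- The renaming which moves the parameter `a` to the end. -/
def moveLast (a : Fin (ℓ + 1)) : Fin (ℓ + 1) → Fin (ℓ + 1) :=
  fun p => Fin.insertNth (α := fun _ => Fin (ℓ + 1)) a (Fin.last ℓ) Fin.castSucc p

theorem moveLast_self (a : Fin (ℓ + 1)) : moveLast a a = Fin.last ℓ := by simp [moveLast]

theorem moveLast_succAbove (a : Fin (ℓ + 1)) (p : Fin ℓ) :
    moveLast a (a.succAbove p) = p.castSucc := by simp [moveLast]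

/-- Since binders commute, any parameter may be taken as the innermost one. -/
theorem close_moveLast (I : Fin (ℓ + 1) → ℕ × ℕ) (a : Fin (ℓ + 1)) (x : Alg Δ (ℓ + 1)) :
    close I x = close (fun p => I (a.succAbove p)) (nu (I a) (rename (moveLast a) x)) := by
  induction ℓ with
  | zero =>
    obtain rfl : a = Fin.last 0 := Fin.ext (by omega)
    rw [rename_eq_self (funext fun p => Fin.ext (by omega))]
    simp only [Fin.succAbove_last]
    rfl
  | succ ℓ ih =>
    revert a
    refine Fin.lastCases ?_ (fun a => ?_)
    · rw [rename_eq_self]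
      · simp only [Fin.succAbove_last]
        rfl
      · funext p
        refine Fin.lastCases (moveLast_self _) (fun p => ?_) p
        have := moveLast_succAbove (Fin.last (ℓ + 1)) p
        rwa [Fin.succAbove_last] at this
    · rw [close, ih (fun p => I p.castSucc) a, rename_nu, nu_nu, rename_rename]
      rw [close]
      congr 1
      · funext p
        rw [Fin.castSucc_succAbove_castSucc]
      · rw [Fin.succAbove_ne_last_last (Fin.castSucc_ne_last a)]
        congr 3
        funext p
        refine Fin.lastCases ?_ (fun p => ?_) p
        · have := moveLast_succAbove a.castSucc (Fin.last ℓ)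
          rw [Fin.succAbove_ne_last_last (Fin.castSucc_ne_last a)] at this
          rw [this]
          simp [liftRen_last, swapLast]
        · simp only [Function.comp_apply, liftRen_castSucc]
          by_cases h : p = a
          · subst h
            simp [moveLast_self, swapLast]
          · obtain ⟨q, rfl⟩ := Fin.exists_succAbove_eq h
            have := moveLast_succAbove a.castSucc q.castSucc
            rw [Fin.castSucc_succAbove_castSucc] at this
            rw [this]
            simp [moveLast_succAbove, swapLast]

/-- Parameters outside the image of `ρ` are unused and get discarded; the remaining binders are only
permuted. -/
theorem close_rename {ρ : Fin ℓ → Fin ℓ'} (hρ : Function.Injective ρ) (I : Fin ℓ' → ℕ × ℕ)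
    (x : Alg Δ ℓ) : close I (rename ρ x) = close (fun a => I (ρ a)) x := by
  induction ℓ' generalizing ℓ with
  | zero =>
    obtain rfl : ℓ = 0 := by
      cases ℓ with
      | zero => rfl
      | succ n => exact (ρ 0).elim0
    rw [rename_eq_self (Subsingleton.elim _ _)]
    rfl
  | succ ℓ' ih =>
    by_cases h : ∃ a, ρ a = Fin.last ℓ'
    · obtain ⟨a, ha⟩ := h
      cases ℓ with
      | zero => exact a.elim0
      | succ ℓ =>
        have hne : ∀ p, ρ (a.succAbove p) ≠ Fin.last ℓ' := fun p hp =>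
          Fin.succAbove_ne a p (hρ (hp.trans ha.symm))
        have hr : ρ = liftRen (fun p => (ρ (a.succAbove p)).castPred (hne p)) ∘ moveLast a := by
          funext p
          by_cases h : p = a
          · subst h
            simp [moveLast_self, liftRen_last, ha]
          · obtain ⟨q, rfl⟩ := Fin.exists_succAbove_eq h
            simp [moveLast_succAbove, liftRen_castSucc]
        rw [close_moveLast (fun a => I (ρ a)) a, close]
        conv_lhs => rw [hr]
        rw [← rename_rename, ← rename_nu, ih, ha]
        · simp
        · intro p q hpq
          simp only [Fin.castPred_inj] at hpq
          exact Fin.succAbove_right_injective (hρ hpq)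
    · push Not at h
      have hr : ρ = Fin.castSucc ∘ fun p => (ρ p).castPred (h p) := by
        funext p
        simp
      rw [close]
      conv_lhs => rw [hr]
      rw [← rename_rename, nu_weaken, ih]
      · simp
      · intro p q hpq
        simp only [Fin.castPred_inj] at hpq
        exact hρ hpq

end Alg

end BetaBernoulli

/-! ### Normal forms: closed terms as mixtures of canonical atoms. -/

namespace BetaBernoulli

/-- The least element of the fibre of `τ` through `a`. -/
def rep {m : ℕ} {α : Type*} [DecidableEq α] (τ : Fin m → α) (a : Fin m) : Fin m :=
  (Finset.univ.filter fun b => τ b = τ a).min' ⟨a, by simp⟩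

section rep

variable {m : ℕ} {α β : Type*} [DecidableEq α] [DecidableEq β]

theorem apply_rep (τ : Fin m → α) (a : Fin m) : τ (rep τ a) = τ a := by
  have := Finset.min'_mem (Finset.univ.filter fun b => τ b = τ a) ⟨a, by simp⟩
  exact (Finset.mem_filter.1 this).2

/-- `rep` uses its map only through equality tests between values, so it is a canonical form for the
kernel, even across different codomains. -/
theorem rep_eq_of_ker (τ : Fin m → α) (τ' : Fin m → β)
    (h : ∀ a b, τ a = τ b ↔ τ' a = τ' b) : rep τ = rep τ' := by
  funext a
  simp only [rep, h]

theorem rep_eq_rep_iff (τ : Fin m → α) (a b : Fin m) : rep τ a = rep τ b ↔ τ a = τ b := by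
  constructor
  · intro h
    exact (apply_rep τ a).symm.trans ((congrArg τ h).trans (apply_rep τ b))
  · intro h
    simp only [rep, h]

theorem rep_rep (τ : Fin m → α) : rep (rep τ) = rep τ :=
  rep_eq_of_ker _ _ (rep_eq_rep_iff τ)

theorem rep_apply_rep (τ : Fin m → α) (a : Fin m) : rep τ (rep τ a) = rep τ a :=
  (rep_eq_rep_iff τ _ _).2 (apply_rep τ a)

end rep

/-- A canonical binding of the arguments of a variable: the arguments are identified according to
`arg`, which is in canonical form, and the indices of the parameters that occur have sum `N`. -/
structure Pattern (n N : ℕ) where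
  /-- The arguments. -/
  arg : Fin n → Fin n
  /-- The indices of the parameters. -/
  idx : Fin n → ℕ × ℕ
  rep_arg : rep arg = arg
  idx_sum : ∀ a, arg a = a → (idx a).1 + (idx a).2 = N
  idx_zero : ∀ a, arg a ≠ a → idx a = (0, 0)

theorem Pattern.ext_of_fst {n N : ℕ} {A B : Pattern n N} (h : A.arg = B.arg)
    (h' : ∀ a, (A.idx a).1 = (B.idx a).1) : A = B := by
  have : A.idx = B.idx := by
    funext a
    by_cases ha : A.arg a = a
    · have h1 := A.idx_sum a ha
      have h2 := B.idx_sum a (by rwa [← h])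
      have h3 := h' a
      exact Prod.ext h3 (by omega)
    · rw [A.idx_zero a ha, B.idx_zero a (by rwa [← h])]
  cases A
  cases B
  simp only at h this
  subst h this
  rfl

theorem Pattern.idx_le {n N : ℕ} (A : Pattern n N) (a : Fin n) : (A.idx a).1 ≤ N := by
  by_cases ha : A.arg a = a
  · have := A.idx_sum a ha
    omega
  · simp [A.idx_zero a ha]

instance {n N : ℕ} : Finite (Pattern n N) := by
  refine Finite.of_injective
    (β := (Fin n → Fin n) × (Fin n → Fin (N + 1)))
    (fun A => (A.arg, fun a => ⟨(A.idx a).1, Nat.lt_succ_of_le (A.idx_le a)⟩)) ?_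
  intro A B h
  refine Pattern.ext_of_fst (congrArg Prod.fst h) fun a => ?_
  exact Fin.val_eq_of_eq (congrFun (congrArg Prod.snd h) a)

/-- A variable together with a canonical binding of its arguments. -/
abbrev Atom {k : ℕ} (m : Fin k → ℕ) (N : ℕ) : Type := (i : Fin k) × Pattern (m i) N

open Alg

variable {k : ℕ} {m : Fin k → ℕ}

/-- The term denoted by an atom. -/
def Atom.toAlg {N : ℕ} (A : Atom m N) : Alg m 0 := close A.2.idx (var A.1 A.2.arg)

/-- Mixtures of atoms. -/
def IsMix (d : Alg m 0) (N : ℕ) (x : Alg m 0) : Prop :=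
  ∃ l : List (Atom m N), l ≠ [] ∧ x = mix d (l.map Atom.toAlg)

theorem IsMix.conv {d : Alg m 0} {N : ℕ} {x y : Alg m 0} (hx : IsMix d N x) (hy : IsMix d N y)
    {i j : ℕ} (h : 0 < i + j) : IsMix d N (conv i j x y) := by
  obtain ⟨l, hl, rfl⟩ := hx
  obtain ⟨l', hl', rfl⟩ := hy
  have h1 := List.length_pos_of_ne_nil hl
  have h2 := List.length_pos_of_ne_nil hl'
  refine ⟨(List.replicate (i * l'.length) l).flatten ++
    (List.replicate (j * l.length) l').flatten, ?_, ?_⟩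
  · rw [← List.length_pos_iff_ne_nil]
    simp only [List.length_append, List.length_flatten, List.map_replicate, List.sum_replicate,
      smul_eq_mul]
    rcases Nat.eq_zero_or_pos i with rfl | hi
    · have : 0 < j := by omega
      positivity
    · positivity
  · rw [conv_mix d h (by simpa using hl) (by simpa using hl')]
    simp [List.map_flatten, List.map_replicate]

/-- A single atom suffices: the argument map matters only up to its kernel, and parameters that do
not occur can be dropped. -/
theorem IsMix.close_var (d : Alg m 0) {N ℓ : ℕ} (i : Fin k) (τ : Fin (m i) → Fin ℓ)
    (I : Fin ℓ → ℕ × ℕ) (hI : ∀ p, (I p).1 + (I p).2 = N) : IsMix d N (close I (var i τ)) := by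
  classical
  let S := {a : Fin (m i) // rep τ a = a}
  let e : S ≃ Fin (Fintype.card S) := Fintype.equivFin S
  let J : Fin (m i) → ℕ × ℕ := fun a => if rep τ a = a then I (τ a) else (0, 0)
  refine ⟨[⟨i, ⟨rep τ, J, rep_rep τ, fun a ha => ?_, fun a ha => ?_⟩⟩], by simp, ?_⟩
  · simp only [J, if_pos ha, hI]
  · simp only [J, if_neg ha]
  -- Both argument maps factor through the surjection `τ₀` onto the classes of equal arguments: `rep
  -- τ` along the injection `ρ₁`, and `τ` along the injection `τ ∘ ρ₁`. Hence `close_rename` reduces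
  -- both closures to the same term.
  let ρ₁ : Fin (Fintype.card S) → Fin (m i) := fun r => (e.symm r).1
  let τ₀ : Fin (m i) → Fin (Fintype.card S) := fun a => e ⟨rep τ a, rep_apply_rep τ a⟩
  have h1 : ρ₁ ∘ τ₀ = rep τ := by
    funext a
    simp [ρ₁, τ₀]
  have h2 : (τ ∘ ρ₁) ∘ τ₀ = τ := by
    rw [Function.comp_assoc, h1]
    exact funext (apply_rep τ)
  have i1 : Function.Injective ρ₁ := fun a b h => e.symm.injective (Subtype.ext h)
  have i2 : Function.Injective (τ ∘ ρ₁) := by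
    intro a b h
    have := (rep_eq_rep_iff τ _ _).2 h
    rw [(e.symm a).2, (e.symm b).2] at this
    exact i1 this
  rw [List.map_singleton, mix_singleton]
  change _ = close J (var i (rep τ))
  rw [← h1, ← rename_var, close_rename i1]
  conv_lhs => rw [← h2, ← rename_var, close_rename i2]
  congr 1
  funext a
  exact (if_pos (e.symm a).2).symm

/-- Induction on the total deficit of the index sums from `N`. -/
theorem IsMix.close_var_of_le (d : Alg m 0) {N ℓ : ℕ} (i : Fin k) (τ : Fin (m i) → Fin ℓ)
    (I : Fin ℓ → ℕ × ℕ) (hI : ∀ p, (I p).1 + (I p).2 ≤ N) : IsMix d N (close I (var i τ)) := by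
  induction h : ∑ p, (N - ((I p).1 + (I p).2)) using Nat.strong_induction_on generalizing I with
  | _ n ih =>
    subst h
    by_cases hall : ∀ p, (I p).1 + (I p).2 = N
    · exact IsMix.close_var d i τ I hall
    · push Not at hall
      obtain ⟨p, hp⟩ := hall
      have hlt : (I p).1 + (I p).2 < N := lt_of_le_of_ne (hI p) hp
      have step : ∀ z : ℕ × ℕ, z.1 + z.2 = (I p).1 + (I p).2 + 1 →
          IsMix d N (close (Function.update I p z) (var i τ)) := by
        intro z hz
        refine ih _ ?_ _ ?_ rfl
        · refine Finset.sum_lt_sum (fun q _ => ?_) ⟨p, Finset.mem_univ _, ?_⟩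
          · by_cases hq : q = p
            · subst hq
              rw [Function.update_self]
              omega
            · rw [Function.update_of_ne hq]
          · rw [Function.update_self]
            omega
        · intro q
          by_cases hq : q = p
          · subst hq
            rw [Function.update_self]
            omega
          · rw [Function.update_of_ne hq]
            exact hI q
      -- A dummy choice at `p` followed by conjugacy replaces the closure by a mixture of two whose
      -- index sum at `p` is larger by one.
      rw [← pch_self p (var i τ), close_pch]
      exact (step _ (by simp only []; omega)).conv (step _ (by simp only []; omega)) (by omega)

/-- The claim is made for all large `N` so that the two branches of a choice can be given a common
level. -/
theorem exists_isMix_close (d : Alg m 0) {ℓ : ℕ} (t : Term m ℓ) (I : Fin ℓ → ℕ × ℕ) :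
    ∃ N₀, ∀ N, N₀ ≤ N → IsMix d N (close I (mk t)) := by
  induction t with
  | var i τ =>
    refine ⟨∑ p, ((I p).1 + (I p).2), fun N hN => IsMix.close_var_of_le d i τ I fun p => ?_⟩
    exact (Finset.single_le_sum (f := fun p => (I p).1 + (I p).2) (fun _ _ => Nat.zero_le _)
      (Finset.mem_univ p)).trans hN
  | nu i j hi hj t ih =>
    obtain ⟨i, rfl⟩ := Nat.exists_eq_add_of_lt hi
    obtain ⟨j, rfl⟩ := Nat.exists_eq_add_of_lt hj
    obtain ⟨N₀, h⟩ := ih (Fin.snoc (α := fun _ => ℕ × ℕ) I (i, j))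
    refine ⟨N₀, fun N hN => ?_⟩
    have := h N hN
    simp only [close, Fin.snoc_last, Fin.snoc_castSucc, nu_mk] at this
    convert this using 3
    congr 1 <;> omega
  | pch p t u iht ihu =>
    obtain ⟨N₁, h₁⟩ := iht (Function.update I p ((I p).1 + 1, (I p).2))
    obtain ⟨N₂, h₂⟩ := ihu (Function.update I p ((I p).1, (I p).2 + 1))
    refine ⟨max N₁ N₂, fun N hN => ?_⟩
    rw [← pch_mk, close_pch]
    exact (h₁ N (le_of_max_le_left hN)).conv (h₂ N (le_of_max_le_right hN)) (by omega)
  | rch i j h t u iht ihu =>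
    obtain ⟨N₁, h₁⟩ := iht I
    obtain ⟨N₂, h₂⟩ := ihu I
    refine ⟨max N₁ N₂, fun N hN => ?_⟩
    rw [← conv_mk h, close_conv I h]
    exact (h₁ N (le_of_max_le_left hN)).conv (h₂ N (le_of_max_le_right hN)) h

theorem exists_eq_mix (t u : Term m 0) :
    ∃ N, IsMix (mk t) N (mk t) ∧ IsMix (mk t) N (mk u) := by
  obtain ⟨N₁, h₁⟩ := exists_isMix_close (mk t) t Fin.elim0
  obtain ⟨N₂, h₂⟩ := exists_isMix_close (mk t) u Fin.elim0
  exact ⟨max N₁ N₂, h₁ _ (le_max_left _ _), h₂ _ (le_max_right _ _)⟩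

end BetaBernoulli

/-! ### Beta densities and integration of the last parameter. -/

namespace BetaBernoulli

/-- The density of the beta distribution with parameters `i + 1` and `j + 1`. -/
noncomputable def betaDensity (I : ℕ × ℕ) (p : ℝ) : ℝ :=
  ((I.1 + I.2 + 1).factorial : ℝ) / (I.1.factorial * I.2.factorial) * (p ^ I.1 * (1 - p) ^ I.2)

theorem continuous_betaDensity (I : ℕ × ℕ) : Continuous (betaDensity I) := by
  unfold betaDensity
  fun_prop

@[fun_prop]
theorem _root_.Continuous.betaDensity {X : Type*} [TopologicalSpace X] (I : ℕ × ℕ) {f : X → ℝ}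
    (hf : Continuous f) : Continuous fun x => betaDensity I (f x) :=
  (continuous_betaDensity I).comp hf

theorem betaDensity_zero (p : ℝ) : betaDensity (0, 0) p = 1 := by simp [betaDensity]

theorem integral_pow_mul_one_sub_pow (i j : ℕ) :
    ∫ p in (0 : ℝ)..1, p ^ i * (1 - p) ^ j =
      (i.factorial * j.factorial : ℝ) / (i + j + 1).factorial := by
  induction j generalizing i with
  | zero =>
    simp only [pow_zero, mul_one, integral_pow, add_zero, Nat.factorial_zero, Nat.cast_one,
      Nat.factorial_succ i]
    have := Nat.factorial_pos i
    push_cast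
    field_simp
    simp
  | succ j ih =>
    -- Integration by parts: this product vanishes at both endpoints, which trades a factor `1 - p`
    -- for a factor `p`.
    have hderiv : ∀ p : ℝ, HasDerivAt (fun p : ℝ => p ^ (i + 1) * (1 - p) ^ (j + 1))
        ((i + 1) * (p ^ i * (1 - p) ^ (j + 1)) - (j + 1) * (p ^ (i + 1) * (1 - p) ^ j)) p := by
      intro p
      have h1 : HasDerivAt (fun p : ℝ => p ^ (i + 1)) ((i + 1) * p ^ i) p := by
        simpa using hasDerivAt_pow (i + 1) p
      have h2 : HasDerivAt (fun p : ℝ => (1 - p) ^ (j + 1)) ((j + 1) * (1 - p) ^ j * (-1)) p := by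
        simpa using ((hasDerivAt_id p).const_sub 1).fun_pow (j + 1)
      exact (h1.fun_mul h2).congr_deriv (by ring)
    have hint := intervalIntegral.integral_eq_sub_of_hasDerivAt (a := 0) (b := 1)
      (fun p _ => hderiv p) (Continuous.intervalIntegrable (by fun_prop) _ _)
    rw [intervalIntegral.integral_sub (Continuous.intervalIntegrable (by fun_prop) _ _)
      (Continuous.intervalIntegrable (by fun_prop) _ _), intervalIntegral.integral_const_mul,
      intervalIntegral.integral_const_mul, ih] at hint
    have e : i + 1 + j + 1 = i + (j + 1) + 1 := by ring
    rw [e] at hint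
    have h1 : ((i + (j + 1) + 1).factorial : ℝ) ≠ 0 := by positivity
    have h2 : (i + 1 : ℝ) ≠ 0 := by positivity
    apply mul_left_cancel₀ h2
    simp only [Nat.factorial_succ i, Nat.factorial_succ j] at hint ⊢
    push_cast at hint ⊢
    simp at hint
    rw [sub_eq_zero] at hint
    rw [hint]
    field_simp

theorem integral_betaDensity (I : ℕ × ℕ) : ∫ p in (0 : ℝ)..1, betaDensity I p = 1 := by
  unfold betaDensity
  rw [intervalIntegral.integral_const_mul, integral_pow_mul_one_sub_pow]
  have h1 := (I.1 + I.2 + 1).factorial_pos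
  have h2 := I.1.factorial_pos
  have h3 := I.2.factorial_pos
  field_simp

/-- Bayes' rule for a success: the predictive probability times the posterior density. With its
counterpart for `1 - p` it gives soundness of conjugacy. -/
theorem mul_betaDensity (I : ℕ × ℕ) (p : ℝ) :
    p * betaDensity I p = (I.1 + 1) / (I.1 + 1 + (I.2 + 1)) * betaDensity (I.1 + 1, I.2) p := by
  have e : I.1 + 1 + I.2 + 1 = (I.1 + I.2 + 1) + 1 := by ring
  simp only [betaDensity, e, Nat.factorial_succ (I.1 + I.2 + 1), Nat.factorial_succ I.1]
  have h2 := I.1.factorial_pos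
  have h3 := I.2.factorial_pos
  push_cast
  have h4 : (I.1 + I.2 + 1 + 1 : ℝ) ≠ 0 := by positivity
  have h5 : (I.1 + 1 + (I.2 + 1) : ℝ) ≠ 0 := by positivity
  field_simp
  ring

theorem one_sub_mul_betaDensity (I : ℕ × ℕ) (p : ℝ) :
    (1 - p) * betaDensity I p =
      (I.2 + 1) / (I.1 + 1 + (I.2 + 1)) * betaDensity (I.1, I.2 + 1) p := by
  have e : I.1 + (I.2 + 1) + 1 = (I.1 + I.2 + 1) + 1 := by ring
  simp only [betaDensity, e, Nat.factorial_succ (I.1 + I.2 + 1), Nat.factorial_succ I.2]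
  have h2 := I.1.factorial_pos
  have h3 := I.2.factorial_pos
  push_cast
  have h4 : (I.1 + I.2 + 1 + 1 : ℝ) ≠ 0 := by positivity
  have h5 : (I.1 + 1 + (I.2 + 1) : ℝ) ≠ 0 := by positivity
  field_simp
  ring

/-- The last parameter integrated against a beta distribution. -/
noncomputable def integrateLast (I : ℕ × ℕ) {ℓ : ℕ} (f : (Fin (ℓ + 1) → ℝ) → ℝ)
    (ρ : Fin ℓ → ℝ) : ℝ :=
  ∫ p in (0 : ℝ)..1, betaDensity I p * f (Fin.snoc (α := fun _ => ℝ) ρ p)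

section integrateLast

variable {ℓ : ℕ} (I : ℕ × ℕ) {f g : (Fin (ℓ + 1) → ℝ) → ℝ}

theorem continuous_snoc {X : Type*} [TopologicalSpace X] {f : X → Fin ℓ → ℝ} {g : X → ℝ}
    (hf : Continuous f) (hg : Continuous g) :
    Continuous fun x => (Fin.snoc (α := fun _ => ℝ) (f x) (g x) : Fin (ℓ + 1) → ℝ) := by
  refine continuous_pi fun a => ?_
  refine Fin.lastCases ?_ (fun a => ?_) a
  · simpa using hg
  · simp only [Fin.snoc_castSucc]
    exact (continuous_apply a).comp hf

theorem continuous_integrand (hf : Continuous f) (ρ : Fin ℓ → ℝ) :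
    Continuous fun p => betaDensity I p * f (Fin.snoc (α := fun _ => ℝ) ρ p) :=
  (continuous_betaDensity I).mul (hf.comp (continuous_snoc continuous_const continuous_id))

theorem continuous_integrateLast (hf : Continuous f) : Continuous (integrateLast I f) := by
  refine intervalIntegral.continuous_parametric_intervalIntegral_of_continuous' ?_ 0 1
  exact ((continuous_betaDensity I).comp continuous_snd).mul
    (hf.comp (continuous_snoc continuous_fst continuous_snd))

theorem integrateLast_add (hf : Continuous f) (hg : Continuous g) :
    integrateLast I (fun ρ => f ρ + g ρ) = fun ρ => integrateLast I f ρ + integrateLast I g ρ := by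
  funext ρ
  simp only [integrateLast, mul_add]
  exact intervalIntegral.integral_add ((continuous_integrand I hf ρ).intervalIntegrable _ _)
    ((continuous_integrand I hg ρ).intervalIntegrable _ _)

theorem integrateLast_mul (c : (Fin ℓ → ℝ) → ℝ) (f : (Fin (ℓ + 1) → ℝ) → ℝ) :
    integrateLast I (fun ρ => c (fun a => ρ a.castSucc) * f ρ) =
      fun ρ => c ρ * integrateLast I f ρ := by
  funext ρ
  simp only [integrateLast, Fin.snoc_castSucc]
  rw [← intervalIntegral.integral_const_mul]
  congr 1
  funext p
  ring

theorem integrateLast_const (f : (Fin ℓ → ℝ) → ℝ) :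
    integrateLast I (fun ρ => f (fun a => ρ a.castSucc)) = f := by
  funext ρ
  simp only [integrateLast, Fin.snoc_castSucc]
  rw [intervalIntegral.integral_mul_const, integral_betaDensity, one_mul]

end integrateLast

/-! ### The beta-Bernoulli model and its soundness. -/

namespace Term

variable {k k' : ℕ} {Δ : Fin k → ℕ} {Δ' : Fin k' → ℕ}

/-- The interpretation of a term, given the interpretation of its variables and parameters. -/
noncomputable def sem (F : (i : Fin k) → (Fin (Δ i) → ℝ) → ℝ) :
    {ℓ : ℕ} → Term Δ ℓ → (Fin ℓ → ℝ) → ℝ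
  | _, var i ps, ρ => F i (fun a => ρ (ps a))
  | _, nu i j _ _ t, ρ => integrateLast (i - 1, j - 1) (t.sem F) ρ
  | _, pch p t u, ρ => ρ p * t.sem F ρ + (1 - ρ p) * u.sem F ρ
  | _, rch i j _ t u, ρ => (i * t.sem F ρ + j * u.sem F ρ) / (i + j)

theorem continuous_sem {F : (i : Fin k) → (Fin (Δ i) → ℝ) → ℝ} (hF : ∀ i, Continuous (F i))
    {ℓ : ℕ} (t : Term Δ ℓ) : Continuous (t.sem F) := by
  induction t with
  | var i ps => exact (hF i).comp (continuous_pi fun a => continuous_apply _)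
  | nu i j hi hj t ih => exact continuous_integrateLast _ ih
  | pch p t u iht ihu => simp only [sem]; fun_prop
  | rch i j h t u iht ihu => simp only [sem]; fun_prop

theorem sem_rename (F : (i : Fin k) → (Fin (Δ i) → ℝ) → ℝ) {ℓ : ℕ} (t : Term Δ ℓ) :
    ∀ {ℓ' : ℕ} (r : Fin ℓ → Fin ℓ') (ρ : Fin ℓ' → ℝ),
      (t.rename r).sem F ρ = t.sem F (fun a => ρ (r a)) := by
  induction t with
  | var i ps => intros; rfl
  | nu i j hi hj t ih =>
    intro ℓ' r ρ
    simp only [rename, sem, integrateLast, ih]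
    congr 1
    funext p
    congr 2
    funext a
    refine Fin.lastCases ?_ (fun a => ?_) a
    · simp [liftRen_last]
    · simp [liftRen_castSucc]
  | pch p t u iht ihu => intros; simp only [rename, sem, iht, ihu]
  | rch i j h t u iht ihu => intros; simp only [rename, sem, iht, ihu]

theorem sem_subst (F : (i : Fin k') → (Fin (Δ' i) → ℝ) → ℝ) {ℓ : ℕ} (t : Term Δ ℓ) :
    ∀ (v : (i : Fin k) → Term Δ' (Δ i + ℓ)) (ρ : Fin ℓ → ℝ),
      (t.subst v).sem F ρ = t.sem (fun i q => (v i).sem F (Fin.append q ρ)) ρ := by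
  induction t with
  | var i ps =>
    intro v ρ
    simp only [subst, sem, sem_rename]
    congr 1
    funext a
    refine Fin.addCases (fun a => ?_) (fun a => ?_) a <;> simp
  | nu i j hi hj t ih =>
    intro v ρ
    simp only [subst, sem, integrateLast, ih, sem_rename]
    congr 1
    funext p
    congr 2
    funext i q
    congr 1
    funext a
    refine Fin.addCases (fun a => ?_) (fun a => ?_) a
    · rw [Fin.append_left]
      exact Fin.append_left _ _ a
    · rw [Fin.append_right]
      refine (Fin.append_right _ _ a.castSucc).trans ?_
      simp
  | pch p t u iht ihu => intros; simp only [subst, sem, iht, ihu]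
  | rch i j h t u iht ihu => intros; simp only [subst, sem, iht, ihu]

end Term

theorem integral_integral_swap_of_continuous {f : ℝ → ℝ → ℝ} (hf : Continuous f.uncurry) :
    ∫ p in (0 : ℝ)..1, ∫ q in (0 : ℝ)..1, f p q = ∫ q in (0 : ℝ)..1, ∫ p in (0 : ℝ)..1, f p q := by
  refine MeasureTheory.intervalIntegral_intervalIntegral_swap ?_
  have : MeasureTheory.IntegrableOn f.uncurry (Set.Icc 0 1 ×ˢ Set.Icc 0 1) :=
    hf.continuousOn.integrableOn_compact (isCompact_Icc.prod isCompact_Icc)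
  refine this.mono_set (Set.prod_mono ?_ ?_) <;>
  · rw [Set.uIoc_of_le zero_le_one]
    exact Set.Ioc_subset_Icc_self

theorem Axiom.sem_eq {k : ℕ} {Δ : Fin k → ℕ} {ℓ : ℕ} {t u : Term Δ ℓ} (h : Axiom t u)
    {F : (i : Fin k) → (Fin (Δ i) → ℝ) → ℝ} (hF : ∀ i, Continuous (F i)) (ρ : Fin ℓ → ℝ) :
    t.sem F ρ = u.sem F ρ := by
  cases h with
  | interchange i j k l hij hkl hik hjl =>
    simp only [Term.sem]
    have h1 : (i + j : ℝ) ≠ 0 := by exact_mod_cast hij.ne'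
    have h2 : (k + l : ℝ) ≠ 0 := by exact_mod_cast hkl.ne'
    have h3 : (i + k : ℝ) ≠ 0 := by exact_mod_cast hik.ne'
    have h4 : (j + l : ℝ) ≠ 0 := by exact_mod_cast hjl.ne'
    push_cast
    rw [mul_div_cancel₀ _ h1, mul_div_cancel₀ _ h2, mul_div_cancel₀ _ h3, mul_div_cancel₀ _ h4]
    congr 1 <;> ring
  | rch_symm i j h =>
    simp only [Term.sem]
    congr 1 <;> ring
  | rch_zero i h =>
    have h1 : (i : ℝ) ≠ 0 := by exact_mod_cast h.ne'
    simp only [Term.sem]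
    rw [Nat.cast_zero, zero_mul, add_zero, add_zero, mul_div_cancel_left₀ _ h1]
  | rch_self i j h =>
    simp only [Term.sem]
    have h1 : (i + j : ℝ) ≠ 0 := by exact_mod_cast h.ne'
    field_simp
  | comm_pch_pch =>
    simp only [Term.sem]
    ring
  | comm_nu_nu i j k l hi hj hk hl =>
    simp only [Term.sem, integrateLast, ← intervalIntegral.integral_const_mul]
    -- Commutativity of binders is Fubini's theorem.
    rw [integral_integral_swap_of_continuous]
    · congr 1
      funext p
      congr 1
      funext q
      have : (fun a => (Fin.snoc (α := fun _ => ℝ) (Fin.snoc (α := fun _ => ℝ) ρ q : Fin 1 → ℝ) p :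
          Fin 2 → ℝ) ((![0, 1] : Fin 2 → Fin 2) a)) =
          fun a => (Fin.snoc (α := fun _ => ℝ) (Fin.snoc (α := fun _ => ℝ) ρ p : Fin 1 → ℝ) q :
          Fin 2 → ℝ) ((![1, 0] : Fin 2 → Fin 2) a) := by
        funext a
        fin_cases a <;> rfl
      rw [this]
      ring
    · have hc : Continuous fun x : ℝ × ℝ => (Fin.snoc (α := fun _ => ℝ)
          (Fin.snoc (α := fun _ => ℝ) ρ x.1 : Fin 1 → ℝ) x.2 : Fin 2 → ℝ) :=
        continuous_snoc (continuous_snoc continuous_const continuous_fst) continuous_snd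
      refine ((continuous_betaDensity _).comp continuous_fst).mul
        (((continuous_betaDensity _).comp continuous_snd).mul ((hF 0).comp
          (continuous_pi fun a => continuous_pi_iff.1 hc _)))
  | comm_nu_pch i j hi hj =>
    have hc : ∀ b : Fin 2, Continuous fun ρ' : Fin 2 → ℝ => F b fun a => ρ' (![1] a) := fun b =>
      (hF b).comp (continuous_pi fun a => continuous_apply _)
    have c1 : Continuous fun ρ' : Fin 2 → ℝ => ρ' 0 * F 0 fun a => ρ' (![1] a) :=
      (continuous_apply 0).mul (hc 0)
    have c2 : Continuous fun ρ' : Fin 2 → ℝ => (1 - ρ' 0) * F 1 fun a => ρ' (![1] a) :=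
      (continuous_const.sub (continuous_apply 0)).mul (hc 1)
    have e1 := integrateLast_mul (i - 1, j - 1) (fun ρ : Fin 1 → ℝ => ρ 0)
      (fun ρ' : Fin 2 → ℝ => F 0 fun a => ρ' (![1] a))
    have e2 := integrateLast_mul (i - 1, j - 1) (fun ρ : Fin 1 → ℝ => 1 - ρ 0)
      (fun ρ' : Fin 2 → ℝ => F 1 fun a => ρ' (![1] a))
    refine (congrFun (integrateLast_add (i - 1, j - 1) c1 c2) ρ).trans ?_
    exact congrArg₂ (· + ·) (congrFun e1 ρ) (congrFun e2 ρ)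
  | comm_nu_rch i j k l hi hj hkl =>
    have hc : ∀ b : Fin 2, Continuous fun ρ' : Fin 1 → ℝ => F b fun a => ρ' (![0] a) := fun b =>
      (hF b).comp (continuous_pi fun a => continuous_apply _)
    have c1 : ∀ (b : Fin 2) (c : ℝ),
        Continuous fun ρ' : Fin 1 → ℝ => c * F b fun a => ρ' (![0] a) :=
      fun b c => continuous_const.mul (hc b)
    have e : (fun ρ' : Fin 1 → ℝ => (k * (F 0 fun a => ρ' (![0] a)) +
        l * (F 1 fun a => ρ' (![0] a))) / (k + l : ℝ)) = fun ρ' =>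
        (k / (k + l : ℝ) * F 0 fun a => ρ' (![0] a)) +
        (l / (k + l : ℝ) * F 1 fun a => ρ' (![0] a)) := by
      funext ρ'
      ring
    have e1 := integrateLast_mul (i - 1, j - 1) (fun _ : Fin 0 → ℝ => k / (k + l : ℝ))
      (fun ρ' : Fin 1 → ℝ => F 0 fun a => ρ' (![0] a))
    have e2 := integrateLast_mul (i - 1, j - 1) (fun _ : Fin 0 → ℝ => l / (k + l : ℝ))
      (fun ρ' : Fin 1 → ℝ => F 1 fun a => ρ' (![0] a))
    simp only [Term.sem]
    change integrateLast (i - 1, j - 1) (fun ρ' : Fin 1 → ℝ => (k * (F 0 fun a => ρ' (![0] a)) +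
        l * (F 1 fun a => ρ' (![0] a))) / (k + l : ℝ)) ρ = _
    rw [e, integrateLast_add _ (c1 _ _) (c1 _ _)]
    refine (congrArg₂ (· + ·) (congrFun e1 ρ) (congrFun e2 ρ)).trans ?_
    change _ = (k * integrateLast (i - 1, j - 1) (fun ρ' : Fin 1 → ℝ => F 0 fun a => ρ' (![0] a)) ρ
      + l * integrateLast (i - 1, j - 1) (fun ρ' : Fin 1 → ℝ => F 1 fun a => ρ' (![0] a)) ρ) /
        (k + l)
    ring
  | comm_pch_rch i j h =>
    simp only [Term.sem]
    ring
  | discard_nu i j hi hj =>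
    refine Eq.trans ?_ (congrFun (integrateLast_const (i - 1, j - 1)
      (fun _ : Fin 0 → ℝ => F 0 fun a => ρ (![] a))) ρ)
    simp only [Term.sem]
    congr 1
    funext ρ'
    exact congrArg (F 0) (funext fun a => a.elim0)
  | discard_pch =>
    simp only [Term.sem]
    ring
  | conjugacy i j hi hj =>
    obtain ⟨i, rfl⟩ := Nat.exists_eq_add_of_lt hi
    obtain ⟨j, rfl⟩ := Nat.exists_eq_add_of_lt hj
    have hc : ∀ b : Fin 2, Continuous fun ρ' : Fin 1 → ℝ => F b fun a => ρ' (![0] a) := fun b =>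
      (hF b).comp (continuous_pi fun a => continuous_apply _)
    have hs : ∀ p : ℝ, (Fin.snoc (α := fun _ => ℝ) ρ p : Fin 1 → ℝ) 0 = p := fun p =>
      Fin.snoc_last (α := fun _ => ℝ) (n := 0) p ρ
    simp only [Term.sem, integrateLast, hs, Nat.zero_add, Nat.add_sub_cancel, mul_add]
    have e : ∀ (p x y : ℝ), betaDensity (i, j) p * (p * x) + betaDensity (i, j) p * ((1 - p) * y) =
        (i + 1) / (i + 1 + (j + 1)) * (betaDensity (i + 1, j) p * x) +
        (j + 1) / (i + 1 + (j + 1)) * (betaDensity (i, j + 1) p * y) := by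
      intro p x y
      linear_combination x * mul_betaDensity (i, j) p + y * one_sub_mul_betaDensity (i, j) p
    simp only [e]
    rw [intervalIntegral.integral_add, intervalIntegral.integral_const_mul,
      intervalIntegral.integral_const_mul]
    · push_cast
      ring
    · exact (continuous_const.mul (continuous_integrand _ (hc 0) ρ)).intervalIntegrable _ _
    · exact (continuous_const.mul (continuous_integrand _ (hc 1) ρ)).intervalIntegrable _ _

theorem Derivable.sem_eq {k : ℕ} {Δ : Fin k → ℕ} {ℓ : ℕ} {t u : Term Δ ℓ} (h : Derivable t u)
    {F : (i : Fin k) → (Fin (Δ i) → ℝ) → ℝ} (hF : ∀ i, Continuous (F i)) :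
    t.sem F = u.sem F := by
  induction h with
  | ax h => exact funext (h.sem_eq hF)
  | substitution r v _ ih =>
    funext ρ
    -- The substituted terms become a new interpretation of the variables, with `ρ` held fixed. The
    -- induction hypothesis applies to it once it is shown to be continuous.
    rw [Term.sem_subst, Term.sem_subst, Term.sem_rename, Term.sem_rename, ih]
    intro i
    refine (Term.continuous_sem hF _).comp (continuous_pi fun a => ?_)
    refine Fin.addCases (fun a => ?_) (fun a => ?_) a
    · simpa using continuous_apply a
    · simpa using continuous_const
  | nu_congr i j hi hj _ ih => funext ρ; simp only [Term.sem, ih hF]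
  | pch_congr p _ _ ih ih' => funext ρ; simp only [Term.sem, ih hF, ih' hF]
  | rch_congr i j h _ _ ih ih' => funext ρ; simp only [Term.sem, ih hF, ih' hF]
  | refl t => rfl
  | symm _ ih => exact (ih hF).symm
  | trans _ _ ih ih' => exact (ih hF).trans (ih' hF)

end BetaBernoulli

/-! ### Expectations under independent beta distributions. -/

namespace BetaBernoulli

/-- The expectation of a function of independent parameters with beta distributions. -/
noncomputable def expect : {ℓ : ℕ} → (Fin ℓ → ℕ × ℕ) → ((Fin ℓ → ℝ) → ℝ) → ℝ
  | 0, _, f => f Fin.elim0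
  | _ + 1, I, f => expect (fun a => I a.castSucc) (integrateLast (I (Fin.last _)) f)

theorem expect_add {ℓ : ℕ} (I : Fin ℓ → ℕ × ℕ) {f g : (Fin ℓ → ℝ) → ℝ} (hf : Continuous f)
    (hg : Continuous g) : expect I (fun ρ => f ρ + g ρ) = expect I f + expect I g := by
  induction ℓ with
  | zero => rfl
  | succ ℓ ih =>
    rw [expect, integrateLast_add _ hf hg,
      ih _ (continuous_integrateLast _ hf) (continuous_integrateLast _ hg), expect, expect]

theorem expect_const_mul {ℓ : ℕ} (I : Fin ℓ → ℕ × ℕ) (c : ℝ) (f : (Fin ℓ → ℝ) → ℝ) :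
    expect I (fun ρ => c * f ρ) = c * expect I f := by
  induction ℓ with
  | zero => rfl
  | succ ℓ ih => rw [expect, integrateLast_mul _ (fun _ => c), ih, expect]

/-- A change of measure: all expectations are compared under the uniform distribution, which has
indices `(0, 0)`. -/
theorem expect_eq_uniform {ℓ : ℕ} (I : Fin ℓ → ℕ × ℕ) (f : (Fin ℓ → ℝ) → ℝ) :
    expect I f = expect (fun _ => (0, 0)) (fun ρ => (∏ a, betaDensity (I a) (ρ a)) * f ρ) := by
  induction ℓ with
  | zero => simp [expect]
  | succ ℓ ih =>
    rw [expect, ih, expect]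
    congr 1
    rw [← integrateLast_mul _ (fun ρ : Fin ℓ → ℝ => ∏ a, betaDensity (I a.castSucc) (ρ a))]
    funext ρ
    simp only [integrateLast, betaDensity_zero, Fin.prod_univ_castSucc, Fin.snoc_castSucc,
      Fin.snoc_last]
    congr 1
    funext p
    ring

/-- A nonnegative continuous function with zero integral vanishes on the cube, one coordinate at a
time. -/
theorem eq_zero_of_expect_eq_zero {ℓ : ℕ} {f : (Fin ℓ → ℝ) → ℝ} (hf : Continuous f)
    (hn : ∀ ρ, 0 ≤ f ρ) (h : expect (fun _ => (0, 0)) f = 0) (ρ : Fin ℓ → ℝ)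
    (hρ : ∀ a, ρ a ∈ Set.Icc (0 : ℝ) 1) : f ρ = 0 := by
  induction ℓ with
  | zero => rwa [Subsingleton.elim ρ Fin.elim0]
  | succ ℓ ih =>
    have h1 := ih (continuous_integrateLast (0, 0) hf) (fun ρ => ?_) h (fun a => ρ a.castSucc)
      (fun a => hρ _)
    · by_contra hne
      have hs : (Fin.snoc (α := fun _ => ℝ) (fun a => ρ a.castSucc) (ρ (Fin.last ℓ)) :
          Fin (ℓ + 1) → ℝ) = ρ := Fin.snoc_init_self ρ
      refine (intervalIntegral.integral_pos one_pos
        (continuous_integrand (0, 0) hf (fun a => ρ a.castSucc)).continuousOn (fun p _ => ?_)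
        ⟨ρ (Fin.last ℓ), hρ _, ?_⟩).ne' h1
      · rw [betaDensity_zero, one_mul]
        exact hn _
      · rw [betaDensity_zero, one_mul, hs]
        exact lt_of_le_of_ne (hn _) (Ne.symm hne)
    · refine intervalIntegral.integral_nonneg zero_le_one fun p _ => ?_
      rw [betaDensity_zero, one_mul]
      exact hn _

namespace Alg

variable {k : ℕ} {Δ : Fin k → ℕ} {ℓ : ℕ}

/-- The interpretation of terms modulo derivable equality. -/
noncomputable def sem (F : (i : Fin k) → (Fin (Δ i) → ℝ) → ℝ) (hF : ∀ i, Continuous (F i)) :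
    Alg Δ ℓ → (Fin ℓ → ℝ) → ℝ :=
  Quotient.lift (Term.sem F) (fun _ _ h => Derivable.sem_eq h hF)

variable {F : (i : Fin k) → (Fin (Δ i) → ℝ) → ℝ} (hF : ∀ i, Continuous (F i))

theorem sem_mk (t : Term Δ ℓ) : sem F hF (mk t) = t.sem F := rfl

theorem sem_nu (I : ℕ × ℕ) (x : Alg Δ (ℓ + 1)) :
    sem F hF (nu I x) = integrateLast I (sem F hF x) := by
  induction x using ind with
  | h t => rfl

theorem sem_close (I : Fin ℓ → ℕ × ℕ) (x : Alg Δ ℓ) :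
    sem F hF (close I x) Fin.elim0 = expect I (sem F hF x) := by
  induction ℓ with
  | zero => rfl
  | succ ℓ ih => rw [close, ih, expect, sem_nu]

theorem sem_conv {i j : ℕ} (h : 0 < i + j) (x y : Alg Δ ℓ) (ρ : Fin ℓ → ℝ) :
    sem F hF (conv i j x y) ρ = (i * sem F hF x ρ + j * sem F hF y ρ) / (i + j) := by
  induction x using ind with | h x
  induction y using ind with | h y
  rw [conv_mk h]
  rfl

/-- Multiplying by the length avoids division and makes the default `d` harmless for the empty list.
-/
theorem sem_mix (d : Alg Δ ℓ) (l : List (Alg Δ ℓ)) (ρ : Fin ℓ → ℝ) :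
    l.length * sem F hF (mix d l) ρ = (l.map fun x => sem F hF x ρ).sum := by
  induction l with
  | nil => simp
  | cons a l ih =>
    rw [mix, sem_conv hF (by omega), List.map_cons, List.sum_cons, ← ih, List.length_cons]
    have : (1 + l.length : ℝ) ≠ 0 := by positivity
    push_cast
    field_simp
    ring

end Alg

/-! ### Polynomial expectations and polynomials defined by ground terms. -/

open MvPolynomial

/-- The expectation of a polynomial as a linear map. -/
noncomputable def expectPoly {ℓ : ℕ} (I : Fin ℓ → ℕ × ℕ) : MvPolynomial (Fin ℓ) ℝ →ₗ[ℝ] ℝ where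
  toFun q := expect I (fun ρ => eval ρ q)
  map_add' p q := by
    simp only [map_add]
    exact expect_add I (MvPolynomial.continuous_eval p) (MvPolynomial.continuous_eval q)
  map_smul' c q := by
    simp only [smul_eval, RingHom.id_apply, smul_eq_mul]
    exact expect_const_mul I c _

/-- The values of the variables of the ground context. -/
def groundVal : (i : Fin 2) → (Fin (Ground i) → ℝ) → ℝ := fun i _ => if i = 0 then 1 else 0

theorem continuous_groundVal (i : Fin 2) : Continuous (groundVal i) := continuous_const

/-- Polynomials which are interpretations of ground terms. -/
def Definable {n : ℕ} (q : MvPolynomial (Fin n) ℝ) : Prop :=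
  ∃ v : Term Ground n, ∀ ρ, v.sem groundVal ρ = eval ρ q

theorem definable_zero {n : ℕ} : Definable (0 : MvPolynomial (Fin n) ℝ) :=
  ⟨Term.var 1 Fin.elim0, fun ρ => by simp [Term.sem, groundVal]⟩

theorem definable_one {n : ℕ} : Definable (1 : MvPolynomial (Fin n) ℝ) :=
  ⟨Term.var 0 Fin.elim0, fun ρ => by simp [Term.sem, groundVal]⟩

theorem Definable.mul_X {n : ℕ} {q : MvPolynomial (Fin n) ℝ} (h : Definable q) (a : Fin n) :
    Definable (q * X a) := by
  obtain ⟨v, hv⟩ := h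
  refine ⟨Term.pch a v (Term.var 1 Fin.elim0), fun ρ => ?_⟩
  simp [Term.sem, groundVal, hv, mul_comm]

/-- Starting from `1` and multiplying by parameters, ground terms define all monomials. -/
theorem mem_span_definable {n : ℕ} (q : MvPolynomial (Fin n) ℝ) :
    q ∈ Submodule.span ℝ {q : MvPolynomial (Fin n) ℝ | Definable q} := by
  induction q using MvPolynomial.induction_on with
  | C a =>
    have : (C a : MvPolynomial (Fin n) ℝ) = a • 1 := by rw [smul_eq_C_mul, mul_one]
    rw [this]
    exact Submodule.smul_mem _ _ (Submodule.subset_span definable_one)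
  | add p q hp hq => exact Submodule.add_mem _ hp hq
  | mul_X p a hp =>
    induction hp using Submodule.span_induction with
    | mem p h => exact Submodule.subset_span (Definable.mul_X h a)
    | zero => simp
    | add p q _ _ hp hq => rw [add_mul]; exact Submodule.add_mem _ hp hq
    | smul c p _ hp => rw [smul_mul_assoc]; exact Submodule.smul_mem _ _ hp

/-! ### Linear independence of the expectations of patterns. -/

/-- The expectation of a polynomial in the arguments of a pattern. -/
noncomputable def Pattern.val {n N : ℕ} (A : Pattern n N) : MvPolynomial (Fin n) ℝ →ₗ[ℝ] ℝ :=
  (expectPoly A.idx).comp (rename A.arg).toLinearMap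

theorem Pattern.val_apply {n N : ℕ} (A : Pattern n N) (q : MvPolynomial (Fin n) ℝ) :
    A.val q = expect A.idx (fun ρ => eval (fun a => ρ (A.arg a)) q) := by
  simp only [Pattern.val, LinearMap.comp_apply, AlgHom.toLinearMap_apply, expectPoly,
    LinearMap.coe_mk, AddHom.coe_mk, eval_rename]
  rfl

/-- The normalizing constant of a beta density. -/
noncomputable def betaCoeff (I : ℕ × ℕ) : ℝ :=
  ((I.1 + I.2 + 1).factorial : ℝ) / (I.1.factorial * I.2.factorial)

theorem betaCoeff_pos (I : ℕ × ℕ) : 0 < betaCoeff I := by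
  have h1 := (I.1 + I.2 + 1).factorial_pos
  have h2 := I.1.factorial_pos
  have h3 := I.2.factorial_pos
  unfold betaCoeff
  positivity

/-- The joint density of independent beta distributions. -/
noncomputable def densityPoly {n : ℕ} (I : Fin n → ℕ × ℕ) : MvPolynomial (Fin n) ℝ :=
  ∏ a, C (betaCoeff (I a)) * (X a ^ (I a).1 * (1 - X a) ^ (I a).2)

theorem eval_densityPoly {n : ℕ} (I : Fin n → ℕ × ℕ) (ρ : Fin n → ℝ) :
    eval ρ (densityPoly I) = ∏ a, betaDensity (I a) (ρ a) := by
  simp [densityPoly, betaDensity, betaCoeff, map_prod]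

theorem expectPoly_eq_uniform {n : ℕ} (I : Fin n → ℕ × ℕ) (q : MvPolynomial (Fin n) ℝ) :
    expectPoly I q = expectPoly (fun _ => (0, 0)) (densityPoly I * q) := by
  simp only [expectPoly, LinearMap.coe_mk, AddHom.coe_mk, map_mul, eval_densityPoly]
  exact expect_eq_uniform I _

/-- Only representatives, which `A.arg` fixes, contribute to the density: elsewhere the indices are
`(0, 0)` and the factor is `1`. -/
theorem Pattern.rename_densityPoly {n N : ℕ} (A : Pattern n N) :
    rename A.arg (densityPoly A.idx) = densityPoly A.idx := by
  simp only [densityPoly, map_prod, map_mul, map_pow, map_sub, map_one, rename_C, rename_X]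
  refine Finset.prod_congr rfl fun a _ => ?_
  by_cases ha : A.arg a = a
  · rw [ha]
  · simp [A.idx_zero a ha]

/-- A polynomial that vanishes on the arguments identified by some pattern unless the pattern is at
least as fine as `σ`. -/
noncomputable def separator {n : ℕ} (σ : Fin n → Fin n) : MvPolynomial (Fin n) ℝ :=
  ∏ a, ∏ b, if σ a = σ b then 1 else X a - X b

theorem eval_separator_eq_zero {n : ℕ} {σ τ : Fin n → Fin n} {a b : Fin n} (h : σ a ≠ σ b)
    (h' : τ a = τ b) (ρ : Fin n → ℝ) : eval (fun a => ρ (τ a)) (separator σ) = 0 := by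
  simp only [separator, map_prod]
  refine Finset.prod_eq_zero (Finset.mem_univ a) (Finset.prod_eq_zero (Finset.mem_univ b) ?_)
  simp [h, h']

theorem rename_separator_ne_zero {n : ℕ} (σ : Fin n → Fin n) : rename σ (separator σ) ≠ 0 := by
  simp only [separator, map_prod]
  refine Finset.prod_ne_zero_iff.2 fun a _ => Finset.prod_ne_zero_iff.2 fun b _ => ?_
  split_ifs with h
  · simp
  · simp only [map_sub, rename_X, sub_ne_zero]
    exact fun e => h (X_injective e)

theorem eq_zero_of_expectPoly_sq {n : ℕ} (p : MvPolynomial (Fin n) ℝ)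
    (h : expectPoly (fun _ => (0, 0)) (p ^ 2) = 0) : p = 0 := by
  refine MvPolynomial.funext_set (fun _ => Set.Icc (0 : ℝ) 1)
    (fun _ => Set.Icc_infinite one_pos) fun ρ hρ => ?_
  have := eq_zero_of_expect_eq_zero (f := fun ρ => eval ρ (p ^ 2))
    (MvPolynomial.continuous_eval _) (fun ρ => by rw [map_pow]; positivity) h ρ
    (fun a => hρ a (Set.mem_univ a))
  rw [map_pow] at this
  rw [map_zero]
  exact pow_eq_zero_iff two_ne_zero |>.1 this

/-- In the odds coordinate `s = p / (1 - p)`, a beta density is a monomial divided by a power of `1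
+ s` that depends only on the index sum. -/
theorem betaDensity_odds (I : ℕ × ℕ) {s : ℝ} (hs : 0 < s) :
    (1 + s) ^ (I.1 + I.2) * betaDensity I (s / (1 + s)) = betaCoeff I * s ^ I.1 := by
  have h : (1 + s) ≠ 0 := by positivity
  have h1 : 1 - s / (1 + s) = 1 / (1 + s) := by field_simp; ring
  rw [betaDensity, h1, ← betaCoeff, div_pow, div_pow, pow_add, one_pow]
  field_simp

/-- Beta densities of a fixed total degree are linearly independent. -/
theorem densityPoly_independent {n N : ℕ} (σ : Fin n → Fin n) (S : Finset (Pattern n N))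
    (hS : ∀ A ∈ S, A.arg = σ) (d : Pattern n N → ℝ) (h : ∑ A ∈ S, d A • densityPoly A.idx = 0)
    (A : Pattern n N) (hA : A ∈ S) : d A = 0 := by
  classical
  let e : Pattern n N → Fin n →₀ ℕ := fun B => Finsupp.equivFunOnFinite.symm fun a => (B.idx a).1
  have hM : ∑ B ∈ S, monomial (e B) (d B * ∏ a, betaCoeff (B.idx a)) = 0 := by
    refine MvPolynomial.funext_set (fun _ => Set.Ioi (0 : ℝ)) (fun _ => Set.Ioi_infinite 0)
      fun s hs => ?_
    have hs' : ∀ a, 0 < s a := fun a => hs a (Set.mem_univ a)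
    have h0 := congrArg (eval fun a => s a / (1 + s a)) h
    simp only [map_sum, smul_eval, eval_densityPoly, map_zero] at h0 ⊢
    -- All patterns in `S` have the same representatives and the same index sum `N`, so one
    -- multiplier clears every denominator. What remains is a combination of distinct monomials.
    have h1 := congrArg (fun x => (∏ a, (1 + s a) ^ (if σ a = a then N else 0)) * x) h0
    simp only [mul_zero, Finset.mul_sum] at h1
    refine (Finset.sum_congr rfl fun B hB => ?_).trans h1
    rw [mul_left_comm, ← Finset.prod_mul_distrib, eval_monomial, Finsupp.prod_fintype _ _ (by simp),
      mul_assoc, ← Finset.prod_mul_distrib]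
    congr 1
    refine Finset.prod_congr rfl fun a _ => ?_
    have : (if σ a = a then N else 0) = (B.idx a).1 + (B.idx a).2 := by
      rw [← hS B hB]
      split_ifs with ha
      · exact (B.idx_sum a ha).symm
      · simp [B.idx_zero a ha]
    rw [this, betaDensity_odds _ (hs' a)]
    rfl
  have hc := congrArg (coeff (e A)) hM
  rw [coeff_sum, Finset.sum_eq_single A] at hc
  · rw [coeff_monomial, if_pos rfl, coeff_zero] at hc
    exact (mul_eq_zero.1 hc).resolve_right
      (Finset.prod_pos fun a _ => betaCoeff_pos (A.idx a)).ne'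
  · intro B hB hBA
    rw [coeff_monomial, if_neg]
    intro he
    refine hBA (Pattern.ext_of_fst ((hS B hB).trans (hS A hA).symm) fun a => ?_)
    exact DFunLike.congr_fun he a
  · exact fun h => absurd hA h

open Classical in
/-- The expectations with respect to different patterns are linearly independent. -/
theorem Pattern.val_independent {n N : ℕ} [Fintype (Pattern n N)] (d : Pattern n N → ℝ)
    (h : ∀ q, ∑ A, d A * A.val q = 0) (A : Pattern n N) : d A = 0 := by
  by_contra hA
  let κ : Pattern n N → Finset (Fin n × Fin n) := fun B => {x | B.arg x.1 = B.arg x.2}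
  -- Among the patterns with nonzero coefficient, `A₀` identifies the fewest pairs of arguments.
  obtain ⟨A₀, hA₀, hmin⟩ := Finset.exists_min_image
    (Finset.univ.filter fun B : Pattern n N => d B ≠ 0) (fun B => (κ B).card) ⟨A, by simpa using hA⟩
  simp only [Finset.mem_filter, Finset.mem_univ, true_and] at hA₀ hmin
  let σ := A₀.arg
  let S : Finset (Pattern n N) := Finset.univ.filter fun B => B.arg = σ
  -- The test polynomial will be `G * separator σ ^ 2`: the separator removes the patterns outside
  -- `S`, and the factor `G` makes the remaining integrand a square.
  let G : MvPolynomial (Fin n) ℝ := ∑ B ∈ S, d B • densityPoly B.idx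
  have hS : ∀ B ∈ S, B.arg = σ := fun B hB => (Finset.mem_filter.1 hB).2
  have hG : rename σ G = G := by
    simp only [G, map_sum, map_smul]
    refine Finset.sum_congr rfl fun B hB => ?_
    rw [← hS B hB, B.rename_densityPoly]
  have hzero : ∀ B, B ∉ S → d B * B.val (G * separator σ ^ 2) = 0 := by
    intro B hB
    by_cases hd : d B = 0
    · rw [hd, zero_mul]
    -- Otherwise `B` identifies no more than `A₀`; by minimality the kernels coincide, and canonical
    -- forms then give `B.arg = σ`, contrary to `B ∉ S`.
    have hex : ∃ a b, σ a ≠ σ b ∧ B.arg a = B.arg b := by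
      by_contra hne
      push Not at hne
      have hsub : κ B ⊆ κ A₀ := by
        intro x hx
        simp only [κ, Finset.mem_filter, Finset.mem_univ, true_and] at hx ⊢
        by_contra hx'
        exact hne _ _ hx' hx
      have heq := Finset.eq_of_subset_of_card_le hsub (hmin B hd)
      refine hB (Finset.mem_filter.2 ⟨Finset.mem_univ _, ?_⟩)
      rw [← B.rep_arg]
      refine (rep_eq_of_ker _ _ fun a b => ?_).trans A₀.rep_arg
      have := congrArg (fun s => (a, b) ∈ s) heq
      simpa [κ] using this
    obtain ⟨a, b, hab, hab'⟩ := hex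
    rw [Pattern.val_apply]
    have : (fun ρ : Fin n → ℝ => eval (fun a => ρ (B.arg a)) (G * separator σ ^ 2)) =
        fun ρ => 0 * (0 : ℝ) := by
      funext ρ
      rw [map_mul, map_pow, eval_separator_eq_zero hab hab']
      simp
    rw [this, expect_const_mul]
    ring
  have hsum := h (G * separator σ ^ 2)
  rw [← Finset.sum_subset (Finset.subset_univ S) fun B _ hB => hzero B hB] at hsum
  have hval : ∀ B ∈ S, d B * B.val (G * separator σ ^ 2) = expectPoly (fun _ => (0, 0))
      ((d B • densityPoly B.idx) * (G * rename σ (separator σ) ^ 2)) := by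
    intro B hB
    rw [Pattern.val, LinearMap.comp_apply, expectPoly_eq_uniform, smul_mul_assoc, map_smul,
      smul_eq_mul, AlgHom.toLinearMap_apply, map_mul (rename B.arg), map_pow (rename B.arg), hS B hB, hG]
  rw [Finset.sum_congr rfl hval, ← map_sum, ← Finset.sum_mul] at hsum
  have hsq : (∑ B ∈ S, d B • densityPoly B.idx) * (G * rename σ (separator σ) ^ 2) =
      (G * rename σ (separator σ)) ^ 2 := by
    change G * _ = _
    ring
  rw [hsq] at hsum
  have hG0 := (mul_eq_zero.1 (eq_zero_of_expectPoly_sq _ hsum)).resolve_right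
    (rename_separator_ne_zero σ)
  exact hA₀ (densityPoly_independent σ S hS d hG0 A₀ (by simp [S, σ]))

-- The functional is linear in each polynomial, so definable polynomials test as much as arbitrary
-- ones.
open Classical in
theorem Atom.val_independent {k : ℕ} {m : Fin k → ℕ} {N : ℕ} [∀ i, Fintype (Pattern (m i) N)]
    (d : Atom m N → ℝ)
    (h : ∀ q : (i : Fin k) → MvPolynomial (Fin (m i)) ℝ, (∀ i, Definable (q i)) →
      ∑ A, d A * A.2.val (q A.1) = 0) (A : Atom m N) : d A = 0 := by
  obtain ⟨i, A⟩ := A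
  refine Pattern.val_independent (fun B => d ⟨i, B⟩) (fun q => ?_) A
  have hspan := mem_span_definable q
  induction hspan using Submodule.span_induction with
  | mem q hq =>
    -- Giving every other variable the definable value `0` isolates the atoms of the variable `i`.
    have := h (Pi.single i q) fun j => ?_
    · rw [Fintype.sum_sigma, Finset.sum_eq_single i] at this
      · simpa using this
      · intro j _ hj
        simp [Pi.single_eq_of_ne hj]
      · simp
    · by_cases hj : j = i
      · subst hj
        simpa using hq
      · rw [Pi.single_eq_of_ne hj]
        exact definable_zero
  | zero => simp
  | add p q _ _ hp hq => simp only [map_add, mul_add, Finset.sum_add_distrib, hp, hq, add_zero]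
  | smul c p _ hp =>
    simp only [map_smul, smul_eq_mul, mul_left_comm _ c, ← Finset.mul_sum, hp, mul_zero]

/-! ### Comparison of the two normal forms. -/

theorem Term.sem_subst_ground {k : ℕ} {m : Fin k → ℕ} (t : Term m 0)
    (v : (i : Fin k) → Term Ground (m i)) (q : (i : Fin k) → MvPolynomial (Fin (m i)) ℝ)
    (hv : ∀ i ρ, (v i).sem groundVal ρ = eval ρ (q i)) (ρ : Fin 0 → ℝ) :
    (t.subst v).sem groundVal ρ = t.sem (fun i ρ => eval ρ (q i)) ρ := by
  refine (Term.sem_subst _ t v ρ).trans ?_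
  congr 1
  funext i ρ'
  rw [← hv]
  refine congrArg ((v i).sem groundVal) (funext fun a => ?_)
  exact Fin.append_left ρ' ρ a

open Classical in
theorem length_mul_sem {k : ℕ} {m : Fin k → ℕ} {N : ℕ} [∀ i, Fintype (Pattern (m i) N)]
    (q : (i : Fin k) → MvPolynomial (Fin (m i)) ℝ) (d : Alg m 0) (l : List (Atom m N))
    (t : Term m 0) (ht : Alg.mk t = Alg.mix d (l.map Atom.toAlg)) :
    l.length * t.sem (fun i ρ => eval ρ (q i)) Fin.elim0 =
      ∑ A, (l.count A : ℝ) * A.2.val (q A.1) := by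
  have hF : ∀ i, Continuous fun ρ : Fin (m i) → ℝ => eval ρ (q i) := fun i =>
    MvPolynomial.continuous_eval (q i)
  rw [← Alg.sem_mk hF, ht, ← List.length_map (f := Atom.toAlg), Alg.sem_mix, List.map_map,
    Finset.sum_list_map_count]
  refine (Finset.sum_subset (Finset.subset_univ _) fun A _ hA => ?_).trans
    (Finset.sum_congr rfl fun A _ => ?_)
  · rw [List.count_eq_zero_of_not_mem (by simpa using hA), zero_smul]
  · rw [nsmul_eq_mul, Function.comp_apply, Atom.toAlg, Alg.sem_close, Pattern.val_apply]
    rfl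

end BetaBernoulli

open BetaBernoulli in
theorem mainTheorem5 {k : ℕ} (m : Fin k → ℕ) (t u : BetaBernoulli.Term m 0)
    (h : ∀ v : (i : Fin k) → BetaBernoulli.Term BetaBernoulli.Ground (m i),
      BetaBernoulli.Derivable (t.subst v) (u.subst v)) :
    BetaBernoulli.Derivable t u := by
  classical
  obtain ⟨N, ⟨l, hl, ht⟩, l', hl', hu⟩ := exists_eq_mix t u
  have : ∀ i, Fintype (Pattern (m i) N) := fun i => Fintype.ofFinite _
  -- Each atom has the same relative frequency in both lists, written without division.
  have key : ∀ A : Atom m N, (l'.length : ℝ) * l.count A - l.length * l'.count A = 0 := by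
    refine Atom.val_independent _ fun q hq => ?_
    choose v hv using hq
    have hs := congrFun ((h v).sem_eq continuous_groundVal) Fin.elim0
    have e1 := length_mul_sem q _ l t ht
    have e2 := length_mul_sem q _ l' u hu
    have et := Term.sem_subst_ground t v q hv Fin.elim0
    have eu := Term.sem_subst_ground u v q hv Fin.elim0
    simp only [sub_mul, Finset.sum_sub_distrib, mul_assoc, ← Finset.mul_sum]
    rw [← e1, ← e2, ← et, ← eu, hs]
    ring
  -- Replicating each list by the length of the other turns equal frequencies into equal
  -- multiplicities.
  have hperm : ((List.replicate l'.length l).flatten).Perm (List.replicate l.length l').flatten := by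
    rw [List.perm_iff_count]
    intro A
    have := sub_eq_zero.1 (key A)
    simp only [List.count_flatten, List.map_replicate, List.sum_replicate, smul_eq_mul]
    exact_mod_cast this
  rw [← Alg.mk_eq_mk, ht, hu,
    ← Alg.mix_replicate _ (List.length_pos_of_ne_nil hl') (l.map Atom.toAlg),
    ← Alg.mix_replicate _ (List.length_pos_of_ne_nil hl) (l'.map Atom.toAlg)]
  refine Alg.mix_perm _ ?_
  simpa [List.map_flatten, List.map_replicate] using hperm.map Atom.toAlg
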